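/- **Setting.** Let $\beta\in(0,1)$, $n\in\mathbb N$, and let $B_2\subset B_1\subset B$ be Banach spaces with norms $\|\cdot\|_2\ge\|\cdot\|_1\ge\|\cdot\|$, $B_2$ dense in $B_1$ and $B_1$ dense in $B$. Let $B^{par}$ be a Banach space with norm $\|\cdot\|_{par}$. Assume conditions (A): (i) $D_1,\dots,D_n\in\mathcal L(B_1,B)\cap\mathcal L(B_2,B_1)$, with norms at most $1$ in both spaces; write $D=(D_1,\dots,D_n)$. (ii) $A\in\mathcal L(B_2,B)$ generates a strongly continuous semigroup $e^{At}$ in $B$, which restricts to a strongly continuous semigroup in $B_1$, with $\|e^{At}\|_{B\to B}\le Me^{mt}$ and $\|e^{At}\|_{B_1\to B_1}\le M_1e^{m_1t}$ for $t\ge0$, where $M,m,M_1,m_1\ge0$; and $B_2$ is an invariant core of this semigroup in $B$. (iii) $H:\mathbb R\times B\times B^n\times B^{par}\to B$ is continuous and, with constants $L_H,L_H',L_H^{par}\ge0$, $$\|H(t,b_0,\dots,b_n,\alpha)-H(t,\tilde b_0,\dots,\tilde b_n,\alpha)\|\le L_H\sum_{j=0}^n\|b_j-\tilde b_j\|\Big(1+L_H'\sum_{j=1}^n\|b_j\|\Big),$$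 $$\|H(t,b_0,\dots,b_n,\alpha)-H(t,b_0,\dots,b_n,\tilde\alpha)\|\le L_H^{par}\|\alpha-\tilde\alpha\|_{par}\Big(1+\sum_{j=1}^n\|b_j\|\Big),$$ $$\|H(t,b_0,\dots,b_n,\alpha)\|\le L_H\sum_{j=1}^n\|b_j\|.$$ Assume also the smoothing property: for $t>0$ the operator $e^{At}$ maps $B$ to $B_1$, and $\|e^{At}\|_{B\to B_1}\le\kappa t^{-\omega}$ for $t\in(0,1]$, where $\kappa>0$ and $\omega\in(0,1)$. Let $G_\beta(1,x)=\frac1\pi\,\mathrm{Re}\int_0^\infty\exp\{ipx-p^\beta e^{i\pi\beta/2}\}\,dp$ and, for $\tau\ge0$ and $y\in B$, $$E_\beta(A\tau)y=\frac1\beta\int_0^\infty e^{A\tau x}y\;x^{-1-1/\beta}G_\beta(1,x^{-1/\beta})\,dx,\qquad E_\beta'(A\tau)y=\frac1\beta\int_0^\infty e^{A\tau x}y\;x^{-1/\beta}G_\beta(1,x^{-1/\beta})\,dx .$$ For $a\in\mathbb R$, $Y\in B_1$, $\alpha\in B^{par}$ consider the equation $$b(t)=E_\beta(A(t-a)^\beta)Y+\beta\int_a^t(t-s)^{\beta-1}E_\beta'(A(t-s)^\beta)H(s,b(s),Db(s),\alpha)\,ds.\qquad(*)$$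 **Theorem.** The integrals defining $E_\beta(A\tau)y$ and $E'_\beta(A\tau)y$ converge absolutely, and $(*)$ is well posed in $B_1$: 1. For all $a\in\mathbb R$, $Y\in B_1$, $\alpha\in B^{par}$ there is a continuous $b=b(\cdot\,;Y,\alpha):[a,\infty)\to B_1$ that solves $(*)$ for all $t\ge a$ and satisfies $b(a)=Y$; for every $T\ge a$ it coincides on $[a,T]$ with every continuous $B_1$-valued solution of $(*)$ on $[a,T]$. 2. The solution depends Lipschitz continuously on the parameter and, uniformly for $Y$ in bounded sets, on the initial value: for all $T\ge a$ and $r\ge0$ there is a constant $K$, depending only on $T-a$, $r$ and the constants $n,\beta,M,m,M_1,m_1,\kappa,\omega,L_H,L_H',L_H^{par}$, such that for all $Y,\tilde Y\in B_1$ with $L_H'\|Y\|_1\le r$ and all $\alpha,\tilde\alpha\in B^{par}$ $$\sup_{t\in[a,T]}\|b(t;Y,\alpha)-b(t;\tilde Y,\tilde\alpha)\|_1\le K\left(\|\alpha-\tilde\alpha\|_{par}(1+\|Y\|_1)+\|Y-\tilde Y\|_1\right).$$ In particular, if $L_H'=0$, then $K$ may be chosen independent of $Y$ as well. -/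

import Mathlib

open Set Filter Topology MeasureTheory

universe u₀ u₁ u₂ u₃

noncomputable section

namespace FracMild

/-- The density `G_β(t,x) = (1/π) Re ∫₀^∞ exp(i p x - t p^β e^{iπβ/2}) dp` of the stable
subordinator of index `β`. -/
def stableDensity (β t x : ℝ) : ℝ :=
  Real.pi⁻¹ * (∫ p in Ioi (0 : ℝ),
    Complex.exp (Complex.I * (p : ℂ) * (x : ℂ)
      - (t : ℂ) * ((p ^ β : ℝ) : ℂ) * Complex.exp (Complex.I * (Real.pi : ℂ) * (β : ℂ) / 2))).re

section Semigroup

variable {X : Type*} [NormedAddCommGroup X] [NormedSpace ℝ X]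

/-- `S` restricted to `[0,∞)` is a strongly continuous one-parameter semigroup of bounded
operators; the values `S t` with `t < 0` are irrelevant. -/
structure IsC0Semigroup (S : ℝ → X →L[ℝ] X) : Prop where
  map_zero : S 0 = ContinuousLinearMap.id ℝ X
  map_add : ∀ s t : ℝ, 0 ≤ s → 0 ≤ t → S (s + t) = (S s).comp (S t)
  continuousOn : ∀ x : X, ContinuousOn (fun t : ℝ => S t x) (Ici 0)

/-- `x` lies in the domain of the infinitesimal generator of `S`, and the generator maps `x`
to `y`. -/
def GeneratorMaps (S : ℝ → X →L[ℝ] X) (x y : X) : Prop :=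
  Tendsto (fun t : ℝ => t⁻¹ • (S t x - x)) (𝓝[>] 0) (𝓝 y)

/-- Integrand of the Zolotarev integral for `E_β(Aτ) y`, where `S t = e^{At}`. -/
def mittagLefflerIntegrand (S : ℝ → X →L[ℝ] X) (β τ : ℝ) (y : X) (x : ℝ) : X :=
  (x ^ (-1 - 1 / β) * stableDensity β 1 (x ^ (-1 / β))) • S (τ * x) y

/-- `E_β(Aτ) y = (1/β) ∫₀^∞ e^{Aτx} y x^{-1-1/β} G_β(1, x^{-1/β}) dx`. -/
def mittagLefflerOp (S : ℝ → X →L[ℝ] X) (β τ : ℝ) (y : X) : X :=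
  (1 / β) • ∫ x in Ioi (0 : ℝ), mittagLefflerIntegrand S β τ y x

/-- Integrand of the Zolotarev integral for `E_β'(Aτ) y`, where `S t = e^{At}`. -/
def mittagLefflerDerivIntegrand (S : ℝ → X →L[ℝ] X) (β τ : ℝ) (y : X) (x : ℝ) : X :=
  (x ^ (-1 / β) * stableDensity β 1 (x ^ (-1 / β))) • S (τ * x) y

/-- `E_β'(Aτ) y = (1/β) ∫₀^∞ e^{Aτx} y x^{-1/β} G_β(1, x^{-1/β}) dx`. -/
def mittagLefflerDerivOp (S : ℝ → X →L[ℝ] X) (β τ : ℝ) (y : X) : X :=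
  (1 / β) • ∫ x in Ioi (0 : ℝ), mittagLefflerDerivIntegrand S β τ y x

end Semigroup

section Triple

variable (B₂ : Type u₂) (B₁ : Type u₁) (B : Type u₀)
  [NormedAddCommGroup B₂] [NormedSpace ℝ B₂]
  [NormedAddCommGroup B₁] [NormedSpace ℝ B₁]
  [NormedAddCommGroup B] [NormedSpace ℝ B]

/-- A Banach triple `B₂ ⊂ B₁ ⊂ B`: the inclusions are given as injective linear maps which do not
increase the norm and have dense range (completeness of the spaces is assumed separately). -/
structure BanachTriple where
  i₂ : B₂ →L[ℝ] B₁
  i₁ : B₁ →L[ℝ] B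
  injective_i₂ : Function.Injective i₂
  injective_i₁ : Function.Injective i₁
  norm_i₂_le : ∀ b : B₂, ‖i₂ b‖ ≤ ‖b‖
  norm_i₁_le : ∀ b : B₁, ‖i₁ b‖ ≤ ‖b‖
  denseRange_i₂ : DenseRange i₂
  denseRange_i₁ : DenseRange i₁

variable {B₂ B₁ B}

/-- The operators `D₁, …, D_n` belong to `L(B₁, B) ∩ L(B₂, B₁)`, with norms at most `1` in both
spaces. -/
structure DerivationBounds (𝒯 : BanachTriple B₂ B₁ B) {n : ℕ} (D : Fin n → B₁ →L[ℝ] B) :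
    Prop where
  norm_le : ∀ j, ‖D j‖ ≤ 1
  restrict : ∀ j, ∃ D' : B₂ →L[ℝ] B₁, ‖D'‖ ≤ 1 ∧ ∀ b : B₂, 𝒯.i₁ (D' b) = D j (𝒯.i₂ b)

/-- `A ∈ L(B₂, B)` generates the strongly continuous semigroup `S t = e^{At}` in `B`, which
restricts to a strongly continuous semigroup in `B₁`; both satisfy exponential bounds, and `B₂` is
an invariant core: it lies in the domain of the generator, where the generator is `A`, it is
invariant under all `S t`, and the generator is the closure of `A` (in the graph topology). -/
structure GeneratesSemigroup (𝒯 : BanachTriple B₂ B₁ B) (A : B₂ →L[ℝ] B) (S : ℝ → B →L[ℝ] B)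
    (M m M₁ m₁ : ℝ) : Prop where
  semigroup : IsC0Semigroup S
  norm_le : ∀ t : ℝ, 0 ≤ t → ‖S t‖ ≤ M * Real.exp (m * t)
  restrict : ∃ S₁ : ℝ → B₁ →L[ℝ] B₁, IsC0Semigroup S₁ ∧
    (∀ t : ℝ, 0 ≤ t → ∀ b : B₁, 𝒯.i₁ (S₁ t b) = S t (𝒯.i₁ b)) ∧
    ∀ t : ℝ, 0 ≤ t → ‖S₁ t‖ ≤ M₁ * Real.exp (m₁ * t)
  generator : ∀ b : B₂, GeneratorMaps S (𝒯.i₁ (𝒯.i₂ b)) (A b)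
  invariant : ∀ t : ℝ, 0 ≤ t → ∀ b : B₂, ∃ b' : B₂, 𝒯.i₁ (𝒯.i₂ b') = S t (𝒯.i₁ (𝒯.i₂ b))
  core : ∀ x y : B, GeneratorMaps S x y →
    (x, y) ∈ closure (range fun b : B₂ => (𝒯.i₁ (𝒯.i₂ b), A b))

/-- Smoothing: `S t` maps `B` to `B₁` for `t > 0`, and `‖S t‖_{B → B₁} ≤ κ t^{-ω}` for
`t ∈ (0,1]`. -/
structure Smoothing (𝒯 : BanachTriple B₂ B₁ B) (S : ℝ → B →L[ℝ] B) (κ ω : ℝ) : Prop where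
  maps : ∀ t : ℝ, 0 < t → ∀ b : B, ∃ c : B₁, 𝒯.i₁ c = S t b
  bound : ∀ t : ℝ, 0 < t → t ≤ 1 → ∀ (b : B) (c : B₁), 𝒯.i₁ c = S t b →
    ‖c‖ ≤ κ * t ^ (-ω) * ‖b‖

end Triple

section Equation

variable {B₂ : Type u₂} {B₁ : Type u₁} {B : Type u₀} {P : Type u₃}
  [NormedAddCommGroup B₂] [NormedSpace ℝ B₂]
  [NormedAddCommGroup B₁] [NormedSpace ℝ B₁]
  [NormedAddCommGroup B] [NormedSpace ℝ B]
  [NormedAddCommGroup P]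

/-- The conditions on `H(t, b₀, (b₁, …, b_n), α)`: joint continuity, the two Lipschitz
estimates, and linear growth. -/
structure HamiltonianBounds {n : ℕ} (H : ℝ → B → (Fin n → B) → P → B) (L L' Lpar : ℝ) :
    Prop where
  continuous : Continuous fun q : ℝ × B × (Fin n → B) × P => H q.1 q.2.1 q.2.2.1 q.2.2.2
  lipschitz : ∀ (t : ℝ) (x x' : B) (v v' : Fin n → B) (α : P),
    ‖H t x v α - H t x' v' α‖ ≤
      L * (‖x - x'‖ + ∑ j, ‖v j - v' j‖) * (1 + L' * ∑ j, ‖v j‖)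
  lipschitz_par : ∀ (t : ℝ) (x : B) (v : Fin n → B) (α α' : P),
    ‖H t x v α - H t x v α'‖ ≤ Lpar * ‖α - α'‖ * (1 + ∑ j, ‖v j‖)
  growth : ∀ (t : ℝ) (x : B) (v : Fin n → B) (α : P), ‖H t x v α‖ ≤ L * ∑ j, ‖v j‖

/-- The integrand `(t-s)^{β-1} E_β'(A(t-s)^β) H(s, b(s), Db(s), α)` of the mild equation. -/
def mildIntegrand (𝒯 : BanachTriple B₂ B₁ B) (S : ℝ → B →L[ℝ] B) {n : ℕ}
    (D : Fin n → B₁ →L[ℝ] B) (H : ℝ → B → (Fin n → B) → P → B) (β : ℝ) (α : P)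
    (b : ℝ → B₁) (t s : ℝ) : B :=
  (t - s) ^ (β - 1) •
    mittagLefflerDerivOp S β ((t - s) ^ β) (H s (𝒯.i₁ (b s)) (fun j => D j (b s)) α)

/-- `b` is a continuous `B₁`-valued solution on the interval `I` (with left end point `a`) of
`b(t) = E_β(A(t-a)^β) Y + β ∫_a^t (t-s)^{β-1} E_β'(A(t-s)^β) H(s, b(s), Db(s), α) ds`,
the equation being understood in `B`. -/
structure IsMildSolution (𝒯 : BanachTriple B₂ B₁ B) (S : ℝ → B →L[ℝ] B) {n : ℕ}
    (D : Fin n → B₁ →L[ℝ] B) (H : ℝ → B → (Fin n → B) → P → B) (β a : ℝ) (I : Set ℝ)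
    (Y : B₁) (α : P) (b : ℝ → B₁) : Prop where
  continuousOn : ContinuousOn b I
  integrable : ∀ t ∈ I, IntervalIntegrable (mildIntegrand 𝒯 S D H β α b t) volume a t
  equation : ∀ t ∈ I, 𝒯.i₁ (b t) =
    mittagLefflerOp S β ((t - a) ^ β) (𝒯.i₁ Y) +
      β • ∫ s in a..t, mildIntegrand 𝒯 S D H β α b t s

end Equation

end FracMild

end

noncomputable section

namespace FracMild

/-! The proof combines an estimate of the scalar weight in the Zolotarev integrals with a
weighted-norm analysis of a Volterra equation in `B₁`.

Put w(x) = x^{-1-1/β} G_β(1, x^{-1/β}). Rescaling p by x^{1/β} turns w(x) into (πx)⁻¹ Re ∫ exp(s - x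
s^β) dp with s = ip, p > 0. Shifting the contour to Re s = R and integrating by parts removes the
factor 1/x and leaves an absolutely convergent integral, bounded by C_R exp(-c R^β x / 2)
(`zolotarevWeight_eq`, `exists_abs_zolotarevWeight_le`). Since R is free, w decays faster than every
exponential, so both integrals converge whatever the growth rate of e^{At}; positivity of G_β plays
no role. The same formula, Fubini and the inverse Laplace transform of s⁻² give ∫ w = β, that is
E_β(0) = id (`integral_zolotarevWeight`).

Integrated against x w(x), the smoothing bound shows that E_β'(Aτ) maps B to B₁ with norm at most C
τ^{-ω}. With τ = σ^β the kernel of the equation has size σ^{β(1-ω)-1}, which is integrable because ω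
< 1 (`weaklySingular_mildKernel`). By injectivity of B₁ → B the equation is then a Volterra equation
in B₁ (`isMildSolution_Icc_iff`). In the sup norm with weight exp(-μ(t-a)) its integral operator has
norm O(μ^{-β(1-ω)}), hence small for large μ; this gives existence
(`WeaklySingular.exists_solution`) and stability (`WeaklySingular.norm_sub_le`) on the whole of
[a,T] at once.

The nonlinearity is Lipschitz only on bounded sets, but it grows linearly, so ‖b‖ ≤ Q‖Y‖ a priori.
Its Lipschitz estimate involves the size of only one of the two arguments, so the final constant
sees Y only through L'‖Y‖ and does not see the second initial value. -/

/-! ### The function exp(s - x s^β) on the right half plane and the contour shift -/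

/-- The cosine of the largest argument of `s ^ β` on the closed right half plane. -/
def rayCos (β : ℝ) : ℝ := Real.cos (Real.pi / 2 * β)

lemma rayCos_pos {β : ℝ} (hβ : β ∈ Ioo (0 : ℝ) 1) : 0 < rayCos β := by
  have hpi := Real.pi_pos
  apply Real.cos_pos_of_mem_Ioo
  constructor <;> nlinarith [hβ.1, hβ.2]

/-- On the closed right half plane |arg s| ≤ π/2, so |β arg s| ≤ βπ/2 < π/2, and the cosine is
decreasing there. -/
lemma rayCos_mul_le_re_cpow {β : ℝ} (hβ : β ∈ Ioo (0 : ℝ) 1) {s : ℂ} (hs : 0 ≤ s.re) :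
    rayCos β * ‖s‖ ^ β ≤ (s ^ (β : ℂ)).re := by
  have hpi := Real.pi_pos
  rw [Complex.cpow_ofReal_re, mul_comm]
  gcongr
  have h := Complex.abs_arg_le_pi_div_two_iff.2 hs
  rw [← Real.cos_abs (s.arg * β), abs_mul, abs_of_pos hβ.1]
  apply Real.cos_le_cos_of_nonneg_of_le_pi (by positivity [hβ.1])
  · nlinarith [hβ.1, hβ.2]
  · nlinarith [hβ.1, hβ.2]

/-- The function `s ↦ exp (s - x s ^ β)`, whose inverse Laplace transform is the stable density. -/
def stableExp (β x : ℝ) (s : ℂ) : ℂ := Complex.exp (s - x * s ^ (β : ℂ))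

lemma norm_stableExp_le {β : ℝ} (hβ : β ∈ Ioo (0 : ℝ) 1) {x : ℝ} (hx : 0 ≤ x) {s : ℂ}
    (hs : 0 ≤ s.re) :
    ‖stableExp β x s‖ ≤ Real.exp s.re * Real.exp (-(x * (rayCos β * ‖s‖ ^ β))) := by
  rw [stableExp, Complex.norm_exp, ← Real.exp_add]
  apply Real.exp_le_exp.2
  have := mul_le_mul_of_nonneg_left (rayCos_mul_le_re_cpow hβ hs) hx
  simp only [Complex.sub_re, Complex.re_ofReal_mul]
  linarith

/-- The branch point s = 0 is included because β > 0; Cauchy's theorem is applied to rectangles with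
a corner there. -/
lemma continuousOn_stableExp {β : ℝ} (hβ : β ∈ Ioo (0 : ℝ) 1) (x : ℝ) :
    ContinuousOn (stableExp β x) {s : ℂ | 0 ≤ s.re} := by
  intro s hs
  apply ContinuousAt.continuousWithinAt
  have := Complex.continuousAt_cpow_const_of_re_pos (z := s) (w := (β : ℂ)) (Or.inl hs)
    (by simpa using hβ.1)
  unfold stableExp
  fun_prop

lemma hasDerivAt_stableExp {β : ℝ} (x : ℝ) {s : ℂ} (hs : 0 < s.re) :
    HasDerivAt (stableExp β x) (stableExp β x s * (1 - x * (β * s ^ ((β : ℂ) - 1)))) s := by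
  have h := ((hasDerivAt_id s).sub (((hasDerivAt_id s).cpow_const (c := (β : ℂ))
    (Complex.mem_slitPlane_iff.2 (Or.inl hs))).const_mul (x : ℂ))).cexp
  have h' : HasDerivAt (stableExp β x) _ s := h
  convert h' using 1
  simp [stableExp]

lemma stableExp_ofReal {β : ℝ} (x : ℝ) {σ : ℝ} (hσ : 0 ≤ σ) :
    stableExp β x σ = (Real.exp (σ - x * σ ^ β) : ℝ) := by
  simp [stableExp, Complex.ofReal_cpow hσ]

/-- The vertical line `Re s = R`. -/
def vline (R p : ℝ) : ℂ := R + p * Complex.I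

@[simp] lemma vline_re (R p : ℝ) : (vline R p).re = R := by simp [vline]

@[simp] lemma vline_im (R p : ℝ) : (vline R p).im = p := by simp [vline]

lemma continuous_vline (R : ℝ) : Continuous (vline R) := by unfold vline; fun_prop

lemma abs_le_norm_vline (R p : ℝ) : |p| ≤ ‖vline R p‖ := by
  simpa using Complex.abs_im_le_norm (vline R p)

lemma le_norm_vline (R p : ℝ) : R ≤ ‖vline R p‖ := by
  simpa using (le_abs_self _).trans (Complex.abs_re_le_norm (vline R p))

lemma integrableOn_exp_neg_mul_rpow {β c : ℝ} (hβ : 0 < β) (hc : 0 < c) :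
    IntegrableOn (fun p : ℝ => Real.exp (-(c * p ^ β))) (Ioi 0) := by
  simpa using integrableOn_rpow_mul_exp_neg_mul_rpow (p := β) (s := 0) (b := c) (by simp) hβ hc

lemma norm_stableExp_vline_le {β : ℝ} (hβ : β ∈ Ioo (0 : ℝ) 1) {x : ℝ} (hx : 0 ≤ x) {R p : ℝ}
    (hR : 0 ≤ R) (hp : 0 ≤ p) :
    ‖stableExp β x (vline R p)‖ ≤ Real.exp R * Real.exp (-(x * rayCos β * p ^ β)) := by
  refine (norm_stableExp_le hβ hx (by simpa using hR)).trans ?_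
  simp only [vline_re]
  have h1 : p ^ β ≤ ‖vline R p‖ ^ β :=
    Real.rpow_le_rpow hp ((le_abs_self _).trans (abs_le_norm_vline R p)) hβ.1.le
  have h2 := mul_le_mul_of_nonneg_left h1 (mul_nonneg hx (rayCos_pos hβ).le)
  refine mul_le_mul_of_nonneg_left (Real.exp_le_exp.2 ?_) (Real.exp_pos R).le
  linarith

lemma integrableOn_stableExp_vline {β : ℝ} (hβ : β ∈ Ioo (0 : ℝ) 1) {x : ℝ} (hx : 0 < x) {R : ℝ}
    (hR : 0 ≤ R) : IntegrableOn (fun p => stableExp β x (vline R p)) (Ioi 0) := by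
  refine Integrable.mono' ((integrableOn_exp_neg_mul_rpow hβ.1
    (mul_pos hx (rayCos_pos hβ))).const_mul (Real.exp R)) ?_ ?_
  · apply Continuous.aestronglyMeasurable
    exact (continuousOn_stableExp hβ x).comp_continuous (continuous_vline R) (by simpa using hR)
  · filter_upwards [ae_restrict_mem measurableSet_Ioi] with p hp
    exact norm_stableExp_vline_le hβ hx.le hR (le_of_lt hp)

/-- The contour of the inverse Laplace transform may be shifted to the right. -/
lemma re_integral_stableExp_vline {β : ℝ} (hβ : β ∈ Ioo (0 : ℝ) 1) {x : ℝ} (hx : 0 < x) {R : ℝ}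
    (hR : 0 ≤ R) :
    (∫ p in Ioi (0 : ℝ), stableExp β x (vline 0 p)).re =
      (∫ p in Ioi (0 : ℝ), stableExp β x (vline R p)).re := by
  -- Imaginary part of Cauchy's theorem on the rectangle with corners 0 and R + iY. The vertical
  -- sides carry a factor i and contribute real parts; the bottom side is real and drops out. Only
  -- the top side is left, and it vanishes as Y → ∞.
  have key : ∀ Y : ℝ, 0 ≤ Y → (∫ p in (0 : ℝ)..Y, stableExp β x (vline R p)).re -
      (∫ p in (0 : ℝ)..Y, stableExp β x (vline 0 p)).re =
      (∫ σ in (0 : ℝ)..R, stableExp β x (vline σ Y)).im := by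
    intro Y hY
    have h := Complex.integral_boundary_rect_eq_zero_of_continuousOn_of_differentiableOn
      (stableExp β x) 0 (R + Y * Complex.I) ?_ ?_
    · simp only [Complex.zero_re, Complex.zero_im, Complex.add_re, Complex.ofReal_re,
        Complex.mul_re, Complex.I_re, mul_zero, Complex.ofReal_im, Complex.I_im, mul_one, sub_self,
        add_zero, Complex.add_im, Complex.mul_im, zero_add, smul_eq_mul] at h
      have h0 : (∫ σ in (0 : ℝ)..R, stableExp β x (σ + ((0 : ℝ) : ℂ) * Complex.I)).im = 0 := by
        have : (∫ σ in (0 : ℝ)..R, stableExp β x (σ + ((0 : ℝ) : ℂ) * Complex.I)) =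
            ∫ σ in (0 : ℝ)..R, ((Real.exp (σ - x * σ ^ β) : ℝ) : ℂ) := by
          apply intervalIntegral.integral_congr
          intro σ hσ
          rw [uIcc_of_le hR] at hσ
          simp only [Complex.ofReal_zero, zero_mul, add_zero]
          exact stableExp_ofReal x hσ.1
        rw [this, intervalIntegral.integral_ofReal, Complex.ofReal_im]
      have h2 := congrArg Complex.im h
      simp only [Complex.sub_im, Complex.add_im, Complex.mul_im, Complex.I_re, Complex.I_im,
        Complex.zero_im, zero_mul, one_mul, zero_add, h0] at h2
      simp only [vline]
      linarith
    · refine (continuousOn_stableExp hβ x).mono ?_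
      intro s hs
      have := hs.1
      simp [uIcc_of_le hR] at this
      exact this.1
    · intro s hs
      have := hs.1
      simp [hR] at this
      exact (hasDerivAt_stableExp x this.1).differentiableAt.differentiableWithinAt
  have hlim : ∀ ρ : ℝ, 0 ≤ ρ →
      Tendsto (fun Y => (∫ p in (0 : ℝ)..Y, stableExp β x (vline ρ p)).re) atTop
        (𝓝 (∫ p in Ioi (0 : ℝ), stableExp β x (vline ρ p)).re) := fun ρ hρ =>
    (Complex.continuous_re.tendsto _).comp
      (intervalIntegral_tendsto_integral_Ioi 0 (integrableOn_stableExp_vline hβ hx hρ) tendsto_id)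
  have h1 := (hlim R hR).sub (hlim 0 le_rfl)
  have h2 : Tendsto (fun Y => (∫ p in (0 : ℝ)..Y, stableExp β x (vline R p)).re -
      (∫ p in (0 : ℝ)..Y, stableExp β x (vline 0 p)).re) atTop (𝓝 0) := by
    have hb : Tendsto (fun Y : ℝ => Real.exp R * Real.exp (-(x * rayCos β * Y ^ β)) * |R - 0|)
        atTop (𝓝 0) := by
      have : Tendsto (fun Y : ℝ => x * rayCos β * Y ^ β) atTop atTop :=
        (tendsto_rpow_atTop hβ.1).const_mul_atTop (mul_pos hx (rayCos_pos hβ))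
      have := (Real.tendsto_exp_neg_atTop_nhds_zero.comp this).const_mul (Real.exp R)
      simpa using this.mul_const |R - 0|
    apply squeeze_zero_norm' _ hb
    filter_upwards [eventually_ge_atTop 0] with Y hY
    rw [key Y hY]
    refine (Complex.abs_im_le_norm _).trans ?_
    apply intervalIntegral.norm_integral_le_of_norm_le_const
    intro σ hσ
    rw [uIoc_of_le hR] at hσ
    refine (norm_stableExp_vline_le hβ hx.le hσ.1.le hY).trans ?_
    gcongr
    exact hσ.2
  linarith [tendsto_nhds_unique h1 h2]

/-! ### Two explicit transforms -/

lemma integrableOn_affine_mul_exp_neg (u v z : ℂ) (hz : 0 < z.re) :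
    IntegrableOn (fun x : ℝ => (u + v * x * z) * Complex.exp (-(x * z))) (Ioi 0) := by
  have h0 : IntegrableOn (fun x : ℝ => Real.exp (-(z.re * x))) (Ioi 0) := by
    simpa using integrableOn_rpow_mul_exp_neg_mul_rpow (p := 1) (s := 0) (b := z.re)
      (by simp) one_pos hz
  have h1 : IntegrableOn (fun x : ℝ => x * Real.exp (-(z.re * x))) (Ioi 0) := by
    simpa using integrableOn_rpow_mul_exp_neg_mul_rpow (p := 1) (s := 1) (b := z.re)
      (by norm_num) one_pos hz
  refine Integrable.mono' ((h0.const_mul ‖u‖).add (h1.const_mul (‖v‖ * ‖z‖))) ?_ ?_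
  · apply Continuous.aestronglyMeasurable
    fun_prop
  · filter_upwards [ae_restrict_mem measurableSet_Ioi] with x hx
    have hx' : 0 < x := hx
    have h2 : ‖Complex.exp (-(x * z))‖ = Real.exp (-(z.re * x)) := by
      rw [Complex.norm_exp]; simp [mul_comm]
    have h3 : ‖u + v * x * z‖ ≤ ‖u‖ + ‖v‖ * ‖z‖ * x := by
      refine (norm_add_le _ _).trans ?_
      simp only [norm_mul, Complex.norm_real, Real.norm_eq_abs, abs_of_pos hx']
      linarith [mul_right_comm ‖v‖ x ‖z‖]
    rw [norm_mul, h2]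
    calc _ ≤ (‖u‖ + ‖v‖ * ‖z‖ * x) * Real.exp (-(z.re * x)) := by gcongr
      _ = _ := by simp only [Pi.add_apply]; ring

/-- The antiderivative is -((u + v)/z + v x) e^{-xz}. The formula serves twice: u = 0, v = 1/z gives
the Fourier transform of t⁺ e^{-t}; u = 1 - β, v = β, z = s^β gives the total mass of the weight. -/
lemma integral_affine_mul_exp_neg (u v z : ℂ) (hz : 0 < z.re) :
    ∫ x in Ioi (0 : ℝ), (u + v * x * z) * Complex.exp (-(x * z)) = (u + v) / z := by
  have hz0 : z ≠ 0 := by rintro rfl; simp at hz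
  have hd : ∀ x : ℝ, HasDerivAt
      (fun x : ℝ => -((u + v) / z + v * x) * Complex.exp (-(x * z)))
      ((u + v * x * z) * Complex.exp (-(x * z))) x := by
    intro x
    have h1 : HasDerivAt (fun x : ℝ => (x : ℂ)) 1 x := Complex.ofRealCLM.hasDerivAt
    have h2 := (((h1.const_mul v).const_add ((u + v) / z)).neg).mul (h1.mul_const z).neg.cexp
    refine h2.congr_deriv ?_
    have e : (u + v) / z * z = u + v := div_mul_cancel₀ _ hz0
    simp only [Pi.neg_apply]
    linear_combination Complex.exp (-(x * z)) * e
  have ht : Tendsto (fun x : ℝ => -((u + v) / z + v * x) * Complex.exp (-(x * z))) atTop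
      (𝓝 0) := by
    have e0 : Tendsto (fun x : ℝ => Real.exp (-(z.re * x))) atTop (𝓝 0) :=
      Real.tendsto_exp_neg_atTop_nhds_zero.comp (tendsto_id.const_mul_atTop hz)
    have e1 : Tendsto (fun x : ℝ => x * Real.exp (-(z.re * x))) atTop (𝓝 0) := by
      simpa using tendsto_rpow_mul_exp_neg_mul_atTop_nhds_zero 1 z.re hz
    have e2 := (e0.const_mul ‖(u + v) / z‖).add (e1.const_mul ‖v‖)
    simp only [mul_zero, add_zero] at e2
    apply squeeze_zero_norm' _ e2
    filter_upwards [eventually_ge_atTop 0] with x hx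
    have h2 : ‖Complex.exp (-(x * z))‖ = Real.exp (-(z.re * x)) := by
      rw [Complex.norm_exp]; simp [mul_comm]
    rw [norm_mul, h2, norm_neg]
    calc _ ≤ (‖(u + v) / z‖ + ‖v‖ * x) * Real.exp (-(z.re * x)) := by
          gcongr
          refine (norm_add_le _ _).trans ?_
          simp [abs_of_nonneg hx]
      _ = _ := by ring
  have := integral_Ioi_of_hasDerivAt_of_tendsto (hd 0).continuousAt.continuousWithinAt
    (fun x _ => hd x) (integrableOn_affine_mul_exp_neg u v z hz) ht
  rw [this]
  simp

lemma one_add_sq_le_norm_vline {R : ℝ} (hR : 1 ≤ R) (p : ℝ) :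
    (1 + ‖p‖ ^ 2) ^ (1 / 2 : ℝ) ≤ ‖vline R p‖ := by
  rw [← Real.sqrt_eq_rpow]
  apply Real.sqrt_le_iff.2 ⟨norm_nonneg _, ?_⟩
  rw [Complex.sq_norm, Complex.normSq_apply]
  simp
  nlinarith

/-- For R ≥ 1 one has |s|² = R² + p² ≥ 1 + p². The exponent is kept as `-(-e) / 2` to fit
`integrable_rpow_neg_one_add_norm_sq`. -/
lemma norm_vline_rpow_le {R e : ℝ} (hR : 1 ≤ R) (he : e ≤ 0) (p : ℝ) :
    ‖vline R p‖ ^ e ≤ (1 + ‖p‖ ^ 2) ^ (-(-e) / 2) := by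
  have h0 : (0 : ℝ) < 1 + ‖p‖ ^ 2 := by positivity
  refine (Real.rpow_le_rpow_of_nonpos (by positivity) (one_add_sq_le_norm_vline hR p) he).trans ?_
  rw [← Real.rpow_mul h0.le]
  apply le_of_eq
  congr 1
  ring

lemma integrable_one_add_sq_rpow {e : ℝ} (he : e < -1) :
    Integrable fun p : ℝ => (1 + ‖p‖ ^ 2) ^ (-(-e) / 2) :=
  integrable_rpow_neg_one_add_norm_sq (by simp; linarith)

lemma vline_mem_slitPlane {R : ℝ} (hR : 0 < R) (p : ℝ) : vline R p ∈ Complex.slitPlane :=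
  Complex.mem_slitPlane_iff.2 (Or.inl (by simpa using hR))

lemma continuous_vline_cpow {R : ℝ} (hR : 0 < R) (w : ℂ) :
    Continuous fun p : ℝ => vline R p ^ w := by
  apply continuous_iff_continuousAt.2
  intro p
  exact ContinuousAt.comp (g := fun s : ℂ => s ^ w)
    (continuousAt_cpow_const (vline_mem_slitPlane hR p)) (continuous_vline R).continuousAt

/-- `π⁻¹ Re ∫_{Re s = 1, Im s > 0} s⁻² eˢ = 1`, from Fourier inversion for `t ↦ t⁺ e^{-t}`. -/
lemma re_integral_vline_inv_sq_mul_exp :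
    (∫ p in Ioi (0 : ℝ), (vline 1 p ^ 2)⁻¹ * Complex.exp (vline 1 p)).re = Real.pi := by
  set f : ℝ → ℂ := fun t => ((max t 0 * Real.exp (-t) : ℝ) : ℂ) with hf
  have hfc : Continuous f := by fun_prop
  have hf_ind : f = (Ioi (0 : ℝ)).indicator fun t : ℝ => (t : ℂ) * Complex.exp (-t) := by
    ext t
    by_cases ht : 0 < t
    · simp [hf, ht, max_eq_left ht.le]
    · simp [hf, ht, max_eq_right (not_lt.1 ht)]
  have hfi : Integrable f := by
    rw [hf_ind, integrable_indicator_iff measurableSet_Ioi]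
    simpa using integrableOn_affine_mul_exp_neg 0 1 1 (by simp)
  have hF : ∀ ξ : ℝ, FourierTransform.fourier f ξ = (vline 1 (2 * Real.pi * ξ) ^ 2)⁻¹ := by
    intro ξ
    have hz : 0 < (vline 1 (2 * Real.pi * ξ)).re := by simp
    have hz0 : vline 1 (2 * Real.pi * ξ) ≠ 0 := by
      intro h; rw [h] at hz; simp at hz
    rw [Real.fourier_eq']
    have h1 := integral_affine_mul_exp_neg 0 (vline 1 (2 * Real.pi * ξ))⁻¹ _ hz
    rw [show (0 + (vline 1 (2 * Real.pi * ξ))⁻¹) / vline 1 (2 * Real.pi * ξ) =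
      (vline 1 (2 * Real.pi * ξ) ^ 2)⁻¹ by field_simp; ring] at h1
    rw [← h1, ← integral_indicator measurableSet_Ioi]
    congr 1
    ext t
    rw [hf_ind]
    by_cases ht : 0 < t
    · simp only [mem_Ioi, ht, indicator_of_mem, smul_eq_mul]
      rw [mul_left_comm, ← Complex.exp_add]
      have : (0 + (vline 1 (2 * Real.pi * ξ))⁻¹ * t * vline 1 (2 * Real.pi * ξ)) = (t : ℂ) := by
        field_simp
        ring
      rw [this]
      congr 2
      simp [vline]
      ring
    · simp [ht]
  have hFi : Integrable (FourierTransform.fourier f) := by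
    have h1 := (integrable_one_add_sq_rpow (e := -2) (by norm_num)).comp_mul_left'
      (R := 2 * Real.pi) (by positivity)
    refine h1.mono' ?_ ?_
    · have : FourierTransform.fourier f = fun ξ : ℝ => (vline 1 (2 * Real.pi * ξ) ^ 2)⁻¹ :=
        funext hF
      rw [this]
      apply Continuous.aestronglyMeasurable
      have := continuous_vline 1
      refine Continuous.inv₀ (by fun_prop) ?_
      intro ξ h
      have := congrArg Complex.re (pow_eq_zero_iff (two_ne_zero)|>.1 h)
      simp at this
    · refine Eventually.of_forall fun ξ => ?_
      rw [hF, norm_inv, norm_pow]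
      have := norm_vline_rpow_le (e := -2) le_rfl (by norm_num) (2 * Real.pi * ξ)
      refine le_trans (le_of_eq ?_) this
      rw [Real.rpow_neg (norm_nonneg _)]
      simp
  -- Inversion is read off at t = 1, where f(1) = e⁻¹ cancels the factor e from Re s = 1.
  have hinv := hfi.fourierInv_fourier_eq hFi (v := 1) hfc.continuousAt
  rw [Real.fourierInv_eq'] at hinv
  simp_rw [hF] at hinv
  have h3 : ∫ p : ℝ, (vline 1 p ^ 2)⁻¹ * Complex.exp (vline 1 p) = 2 * Real.pi := by
    have h4 := Measure.integral_comp_mul_left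
      (fun p : ℝ => (vline 1 p ^ 2)⁻¹ * Complex.exp (vline 1 p)) (2 * Real.pi)
    have h5 : ∫ x : ℝ, (vline 1 (2 * Real.pi * x) ^ 2)⁻¹ *
        Complex.exp (vline 1 (2 * Real.pi * x)) = 1 := by
      have : ∀ x : ℝ, (vline 1 (2 * Real.pi * x) ^ 2)⁻¹ *
        Complex.exp (vline 1 (2 * Real.pi * x)) = Complex.exp 1 * 
          (Complex.exp (↑(2 * Real.pi * inner ℝ x 1) * Complex.I) •
            (vline 1 (2 * Real.pi * x) ^ 2)⁻¹) := by
        intro x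
        simp only [smul_eq_mul]
        rw [← mul_assoc, ← Complex.exp_add, mul_comm]
        congr 2
        simp [vline]
      simp_rw [this]
      rw [integral_const_mul, hinv]
      simp [hf, ← Complex.exp_add]
    rw [h5, abs_of_pos (by positivity)] at h4
    rw [Complex.real_smul] at h4
    have hpi : (Real.pi : ℂ) ≠ 0 := by exact_mod_cast Real.pi_ne_zero
    push_cast at h4
    field_simp at h4
    rw [h4]
    congr 1
    ext p
    rw [div_eq_mul_inv, mul_comm]
  have hgi : Integrable fun p : ℝ => (vline 1 p ^ 2)⁻¹ * Complex.exp (vline 1 p) := by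
    -- A non-integrable function has integral 0 by convention, whereas the value just found is 2π.
    by_contra h
    rw [integral_undef h] at h3
    have : (2 * Real.pi : ℝ) = 0 := by exact_mod_cast h3.symm
    linarith [Real.pi_pos]
  have hsplit := intervalIntegral.integral_Iic_add_Ioi (b := (0 : ℝ)) hgi.integrableOn
    hgi.integrableOn
  -- The lower half of the line is the complex conjugate of the upper half, so the full integral is
  -- twice a real part.
  have hneg : ∫ p in Iic (0 : ℝ), (vline 1 p ^ 2)⁻¹ * Complex.exp (vline 1 p) =
      (starRingEnd ℂ) (∫ p in Ioi (0 : ℝ), (vline 1 p ^ 2)⁻¹ * Complex.exp (vline 1 p)) := by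
    rw [← integral_conj]
    have := integral_comp_neg_Iic 0
      (fun p : ℝ => (starRingEnd ℂ) ((vline 1 p ^ 2)⁻¹ * Complex.exp (vline 1 p)))
    rw [neg_zero] at this
    rw [← this]
    congr 1
    ext p
    have : (starRingEnd ℂ) (vline 1 (-p)) = vline 1 p := by
      apply Complex.ext <;> simp
    rw [map_mul, map_inv₀, map_pow, ← Complex.exp_conj, this]
  rw [hneg, h3] at hsplit
  have := congrArg Complex.re hsplit
  simp at this
  linarith

/-! ### The Zolotarev weight: decay and normalization -/

/-- The weight `x ^ (-1-1/β) G_β(1, x ^ (-1/β))` of the Zolotarev integral. -/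
def zolotarevWeight (β x : ℝ) : ℝ := x ^ (-1 - 1 / β) * stableDensity β 1 (x ^ (-1 / β))

lemma I_mul_cpow {β r : ℝ} (hr : 0 < r) :
    vline 0 r ^ (β : ℂ) =
      ((r ^ β : ℝ) : ℂ) * Complex.exp (Complex.I * (Real.pi : ℂ) * (β : ℂ) / 2) := by
  have h : vline 0 r = (r : ℂ) * Complex.I := by simp [vline]
  rw [h, Complex.cpow_def_of_ne_zero (by simp [hr.ne']), Complex.log_ofReal_mul hr (by simp),
    Complex.log_I, add_mul, Complex.exp_add, Complex.ofReal_cpow hr.le,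
    Complex.cpow_def_of_ne_zero (by simp [hr.ne']), Complex.ofReal_log hr.le]
  congr 2
  ring

/-- Substituting p ↦ x^{1/β} p moves x from the oscillating factor to the coefficient of s^β; the
Jacobian x^{1/β} combines with x^{-1-1/β} to x⁻¹. -/
lemma zolotarevWeight_eq_vline_zero {β x : ℝ} (hβ : 0 < β) (hx : 0 < x) :
    zolotarevWeight β x =
      x⁻¹ * (Real.pi⁻¹ * (∫ p in Ioi (0 : ℝ), stableExp β x (vline 0 p)).re) := by
  rw [zolotarevWeight, stableDensity]
  set g : ℝ → ℂ := fun p => Complex.exp (Complex.I * (p : ℂ) * ((x ^ (-1 / β) : ℝ) : ℂ)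
      - ((1 : ℝ) : ℂ) * ((p ^ β : ℝ) : ℂ) * Complex.exp (Complex.I * (Real.pi : ℂ) * (β : ℂ) / 2))
    with hg
  have hb : 0 < x ^ (1 / β) := Real.rpow_pos_of_pos hx _
  have h1 := integral_comp_mul_left_Ioi g 0 hb
  rw [mul_zero] at h1
  have h2 : ∫ p in Ioi (0 : ℝ), g (x ^ (1 / β) * p) =
      ∫ p in Ioi (0 : ℝ), stableExp β x (vline 0 p) := by
    apply setIntegral_congr_fun measurableSet_Ioi
    intro p hp
    have hp' : 0 < p := hp
    have e1 : x ^ (1 / β) * x ^ (-1 / β) = 1 := by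
      rw [← Real.rpow_add hx]; ring_nf; simp
    have e2 : (x ^ (1 / β) * p) ^ β = x * p ^ β := by
      rw [Real.mul_rpow hb.le hp'.le, ← Real.rpow_mul hx.le, one_div_mul_cancel hβ.ne',
        Real.rpow_one]
    simp only [hg, stableExp]
    rw [I_mul_cpow hp', e2]
    congr 1
    have e1' : ((x ^ (1 / β) : ℝ) : ℂ) * ((x ^ (-1 / β) : ℝ) : ℂ) = 1 := by exact_mod_cast e1
    simp only [vline, Complex.ofReal_mul, Complex.ofReal_zero, Complex.ofReal_one]
    linear_combination (Complex.I * p) * e1'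
  rw [h2] at h1
  have h3 : (∫ p in Ioi (0 : ℝ), g p) =
      (x ^ (1 / β) : ℝ) • ∫ p in Ioi (0 : ℝ), stableExp β x (vline 0 p) := by
    rw [h1, smul_inv_smul₀ hb.ne']
  rw [h3, Complex.smul_re, smul_eq_mul]
  have e3 : x ^ (-1 - 1 / β) * x ^ (1 / β) = x⁻¹ := by
    rw [← Real.rpow_add hx, ← Real.rpow_neg_one]; ring_nf
  rw [← e3]; ring

/-- The integrand obtained from `stableExp` after two integrations by parts. -/
def stableKernel (β x : ℝ) (s : ℂ) : ℂ :=
  s ^ ((β : ℂ) - 2) * ((1 - β) + x * β * s ^ (β : ℂ)) * stableExp β x s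

lemma mul_exp_neg_half_le {y : ℝ} : y * Real.exp (-y / 2) ≤ 2 := by
  have h := Real.add_one_le_exp (y / 2)
  have h1 : Real.exp (-y / 2) * Real.exp (y / 2) = 1 := by rw [← Real.exp_add]; ring_nf; simp
  nlinarith [Real.exp_pos (-y / 2)]

/-- The decay exp(-x c|s|^β) is split into two halves: one absorbs the polynomial factor 1 + x|s|^β,
the other, with |s| ≥ R, gives exponential decay in x. The power |s|^{β-2} is integrable in p since
β < 1. -/
lemma norm_stableKernel_le {β : ℝ} (hβ : β ∈ Ioo (0 : ℝ) 1) {x : ℝ} (hx : 0 ≤ x) {R : ℝ}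
    (hR : 1 ≤ R) (p : ℝ) :
    ‖stableKernel β x (vline R p)‖ ≤
      (1 + 2 / rayCos β) * Real.exp R * Real.exp (-(rayCos β * R ^ β / 2) * x) *
        (1 + ‖p‖ ^ 2) ^ (-(-(β - 2)) / 2) := by
  have hc := rayCos_pos hβ
  set s := vline R p with hs
  set y := rayCos β * ‖s‖ ^ β with hy
  have hsn : 0 ≤ ‖s‖ ^ β := by positivity
  have hRs : R ^ β ≤ ‖s‖ ^ β := Real.rpow_le_rpow (by linarith) (le_norm_vline R p) hβ.1.le
  have h1 : ‖s ^ ((β : ℂ) - 2)‖ = ‖s‖ ^ (β - 2) := by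
    rw [← Complex.norm_cpow_real]; push_cast; rfl
  have h2 : ‖((1 : ℂ) - β) + x * β * s ^ (β : ℂ)‖ ≤ 1 + x * ‖s‖ ^ β := by
    refine (norm_add_le _ _).trans ?_
    have a1 : ‖(1 : ℂ) - β‖ ≤ 1 := by
      rw [show (1 : ℂ) - β = ((1 - β : ℝ) : ℂ) by push_cast; rfl, Complex.norm_real,
        Real.norm_eq_abs, abs_of_pos (by linarith [hβ.2])]
      linarith [hβ.1]
    have a2 : ‖(x : ℂ) * β * s ^ (β : ℂ)‖ ≤ x * ‖s‖ ^ β := by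
      rw [norm_mul, norm_mul, Complex.norm_cpow_real, Complex.norm_real, Complex.norm_real,
        Real.norm_eq_abs, Real.norm_eq_abs, abs_of_nonneg hx, abs_of_pos hβ.1]
      refine mul_le_mul_of_nonneg_right ?_ hsn
      nlinarith [hβ.2]
    linarith
  have h3 : ‖stableExp β x s‖ ≤ Real.exp R * Real.exp (-(x * y)) := by
    have := norm_stableExp_le hβ hx (s := s) (by simp [hs]; linarith)
    simpa [hs] using this
  have h4 : (1 + x * ‖s‖ ^ β) * Real.exp (-(x * y)) ≤
      (1 + 2 / rayCos β) * Real.exp (-(rayCos β * R ^ β / 2) * x) := by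
    have e1 : Real.exp (-(x * y)) = Real.exp (-(x * y) / 2) * Real.exp (-(x * y) / 2) := by
      rw [← Real.exp_add]; ring_nf
    have e2 : Real.exp (-(x * y) / 2) ≤ Real.exp (-(rayCos β * R ^ β / 2) * x) := by
      apply Real.exp_le_exp.2
      have : rayCos β * R ^ β * x ≤ y * x := by rw [hy]; gcongr
      nlinarith
    have e3 : (1 + x * ‖s‖ ^ β) * Real.exp (-(x * y) / 2) ≤ 1 + 2 / rayCos β := by
      have b1 : Real.exp (-(x * y) / 2) ≤ 1 := by
        apply Real.exp_le_one_iff.2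
        have : 0 ≤ x * y := by positivity
        linarith
      have b2 := mul_exp_neg_half_le (y := x * y)
      have b3 : x * ‖s‖ ^ β * Real.exp (-(x * y) / 2) ≤ 2 / rayCos β := by
        rw [le_div_iff₀ hc]
        calc _ = x * y * Real.exp (-(x * y) / 2) := by rw [hy]; ring
          _ ≤ 2 := b2
      linarith
    rw [e1, ← mul_assoc]
    gcongr
  rw [stableKernel, norm_mul, norm_mul, h1]
  have h5 := norm_vline_rpow_le (e := β - 2) hR (by linarith [hβ.2]) p
  calc ‖s‖ ^ (β - 2) * ‖((1 : ℂ) - β) + x * β * s ^ (β : ℂ)‖ * ‖stableExp β x s‖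
      ≤ (1 + ‖p‖ ^ 2) ^ (-(-(β - 2)) / 2) * (1 + x * ‖s‖ ^ β) *
        (Real.exp R * Real.exp (-(x * y))) := by gcongr
    _ = (1 + ‖p‖ ^ 2) ^ (-(-(β - 2)) / 2) * Real.exp R *
        ((1 + x * ‖s‖ ^ β) * Real.exp (-(x * y))) := by ring
    _ ≤ (1 + ‖p‖ ^ 2) ^ (-(-(β - 2)) / 2) * Real.exp R *
        ((1 + 2 / rayCos β) * Real.exp (-(rayCos β * R ^ β / 2) * x)) := by gcongr
    _ = _ := by ring

lemma continuous_stableExp_vline_uncurry {β R : ℝ} (hR : 0 < R) :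
    Continuous fun q : ℝ × ℝ => stableExp β q.1 (vline R q.2) := by
  have h1 := (continuous_vline R).comp (continuous_snd (X := ℝ) (Y := ℝ))
  have h2 := (continuous_vline_cpow hR (β : ℂ)).comp (continuous_snd (X := ℝ) (Y := ℝ))
  unfold stableExp
  simp only [Function.comp_def] at h1 h2
  fun_prop

lemma continuous_stableKernel_uncurry {β R : ℝ} (hR : 0 < R) :
    Continuous fun q : ℝ × ℝ => stableKernel β q.1 (vline R q.2) := by
  have h1 := (continuous_vline_cpow hR ((β : ℂ) - 2)).comp (continuous_snd (X := ℝ) (Y := ℝ))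
  have h2 := (continuous_vline_cpow hR (β : ℂ)).comp (continuous_snd (X := ℝ) (Y := ℝ))
  have h3 := continuous_stableExp_vline_uncurry (β := β) hR
  unfold stableKernel
  simp only [Function.comp_def] at h1 h2
  fun_prop

lemma integrable_stableKernel_vline {β : ℝ} (hβ : β ∈ Ioo (0 : ℝ) 1) {x : ℝ} (hx : 0 ≤ x) {R : ℝ}
    (hR : 1 ≤ R) : Integrable fun p => stableKernel β x (vline R p) := by
  refine Integrable.mono' ((integrable_one_add_sq_rpow (e := β - 2)
    (by linarith [hβ.2])).const_mul ((1 + 2 / rayCos β) * Real.exp R *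
      Real.exp (-(rayCos β * R ^ β / 2) * x))) ?_
    (Eventually.of_forall fun p => norm_stableKernel_le hβ hx hR p)
  exact ((continuous_stableKernel_uncurry (by linarith)).comp
    (Continuous.prodMk_right x)).aestronglyMeasurable

lemma stableExp_vline_tendsto {β : ℝ} (hβ : β ∈ Ioo (0 : ℝ) 1) {x : ℝ} (hx : 0 < x) {R : ℝ}
    (hR : 0 ≤ R) : Tendsto (fun p => stableExp β x (vline R p)) atTop (𝓝 0) := by
  have hb : Tendsto (fun Y : ℝ => Real.exp R * Real.exp (-(x * rayCos β * Y ^ β)))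
      atTop (𝓝 0) := by
    have : Tendsto (fun Y : ℝ => x * rayCos β * Y ^ β) atTop atTop :=
      (tendsto_rpow_atTop hβ.1).const_mul_atTop (mul_pos hx (rayCos_pos hβ))
    simpa using (Real.tendsto_exp_neg_atTop_nhds_zero.comp this).const_mul (Real.exp R)
  apply squeeze_zero_norm' _ hb
  filter_upwards [eventually_ge_atTop 0] with p hp
  exact norm_stableExp_vline_le hβ hx.le hR hp

/-- With E = exp(s - x s^β), the function Q = (1 + xβ s^{β-1}) E satisfies Q' = E - xβ ·
`stableKernel`. It vanishes at the far end of the line and is real at s = R, so the boundary term is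
invisible in the real part. The gain is the factor x, which cancels the singular x⁻¹ of the weight.
-/
lemma re_integral_stableExp_eq_stableKernel {β : ℝ} (hβ : β ∈ Ioo (0 : ℝ) 1) {x : ℝ}
    (hx : 0 < x) {R : ℝ} (hR : 1 ≤ R) :
    (∫ p in Ioi (0 : ℝ), stableExp β x (vline R p)).re =
      x * β * (∫ p in Ioi (0 : ℝ), stableKernel β x (vline R p)).re := by
  have hR0 : 0 < R := by linarith
  set Q : ℂ → ℂ := fun s => (1 + x * β * s ^ ((β : ℂ) - 1)) * stableExp β x s with hQ
  have hd : ∀ p : ℝ, HasDerivAt (fun p => Q (vline R p))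
      (Complex.I * (stableExp β x (vline R p) - x * β * stableKernel β x (vline R p))) p := by
    intro p
    have hs : 0 < (vline R p).re := by simpa using hR0
    have hs0 : vline R p ≠ 0 := by intro h; rw [h] at hs; simp at hs
    have h1 : HasDerivAt (vline R) Complex.I p := by
      have := ((Complex.ofRealCLM.hasDerivAt (x := p)).mul_const Complex.I).const_add (R : ℂ)
      exact HasDerivAt.congr_deriv (f := vline R) this (by simp)
    have h2 : ∀ s : ℂ, 0 < s.re → HasDerivAt Q
        (x * β * ((β - 1) * s ^ ((β : ℂ) - 1 - 1) * 1) * stableExp β x s +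
          (1 + x * β * s ^ ((β : ℂ) - 1)) *
            (stableExp β x s * (1 - x * (β * s ^ ((β : ℂ) - 1))))) s := fun s hs =>
      ((((hasDerivAt_id s).cpow_const (c := (β : ℂ) - 1)
        (Complex.mem_slitPlane_iff.2 (Or.inl hs))).const_mul ((x : ℂ) * β)).const_add 1).mul
        (hasDerivAt_stableExp x hs)
    refine ((h2 (vline R p) hs).comp p h1).congr_deriv ?_
    simp only [stableKernel, mul_one]
    have e0 : vline R p ^ ((β : ℂ) - 1 - 1) = vline R p ^ ((β : ℂ) - 2) := by ring_nf
    have e1 : vline R p ^ ((β : ℂ) - 1) * vline R p ^ ((β : ℂ) - 1) =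
        vline R p ^ ((β : ℂ) - 2) * vline R p ^ (β : ℂ) := by
      rw [← Complex.cpow_add _ _ hs0, ← Complex.cpow_add _ _ hs0]; ring_nf
    rw [e0]
    linear_combination (-Complex.I * x ^ 2 * β ^ 2 * stableExp β x (vline R p)) * e1
  have ht : Tendsto (fun p => Q (vline R p)) atTop (𝓝 0) := by
    have hb := (stableExp_vline_tendsto hβ hx hR0.le).norm.const_mul (1 + x * β)
    simp only [norm_zero, mul_zero] at hb
    apply squeeze_zero_norm _ hb
    intro p
    rw [hQ, norm_mul]
    gcongr
    refine (norm_add_le _ _).trans ?_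
    have h1 : ‖vline R p ^ ((β : ℂ) - 1)‖ ≤ 1 := by
      rw [show (β : ℂ) - 1 = ((β - 1 : ℝ) : ℂ) by push_cast; rfl, Complex.norm_cpow_real]
      exact Real.rpow_le_one_of_one_le_of_nonpos (hR.trans (le_norm_vline R p))
        (by linarith [hβ.2])
    rw [norm_mul, norm_mul, Complex.norm_real, Complex.norm_real, Real.norm_eq_abs,
      Real.norm_eq_abs, abs_of_pos hx, abs_of_pos hβ.1, norm_one]
    have : 0 ≤ x * β := mul_nonneg hx.le hβ.1.le
    nlinarith
  have i1 := integrableOn_stableExp_vline hβ hx hR0.le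
  have i2 : IntegrableOn (fun p => (x : ℂ) * β * stableKernel β x (vline R p)) (Ioi 0) :=
    (integrable_stableKernel_vline hβ hx.le hR).integrableOn.const_mul _
  have h := integral_Ioi_of_hasDerivAt_of_tendsto (hd 0).continuousAt.continuousWithinAt
    (fun p _ => hd p) ((i1.sub i2).const_mul Complex.I) ht
  rw [integral_const_mul, integral_sub i1 i2, integral_const_mul] at h
  have him : (Q (vline R 0)).im = 0 := by
    have e1 : vline R 0 = (R : ℂ) := by simp [vline]
    have e2 : (R : ℂ) ^ ((β : ℂ) - 1) = ((R ^ (β - 1) : ℝ) : ℂ) := by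
      rw [Complex.ofReal_cpow hR0.le]; push_cast; rfl
    rw [hQ]
    simp only [e1, e2, stableExp_ofReal x hR0.le]
    norm_cast
  have h' := congrArg Complex.im h
  simp only [Complex.mul_im, Complex.I_re, Complex.I_im, zero_mul, one_mul, zero_add,
    Complex.sub_re, Complex.sub_im, Complex.zero_im, him, sub_zero] at h'
  rw [← Complex.ofReal_mul, Complex.re_ofReal_mul] at h'
  linarith

lemma zolotarevWeight_eq {β : ℝ} (hβ : β ∈ Ioo (0 : ℝ) 1) {x : ℝ} (hx : 0 < x) {R : ℝ}
    (hR : 1 ≤ R) :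
    zolotarevWeight β x =
      β * (Real.pi⁻¹ * (∫ p in Ioi (0 : ℝ), stableKernel β x (vline R p)).re) := by
  rw [zolotarevWeight_eq_vline_zero hβ.1 hx, re_integral_stableExp_vline hβ hx (by linarith),
    re_integral_stableExp_eq_stableKernel hβ hx hR]
  field_simp

/-- The Zolotarev weight decays faster than any exponential. -/
lemma exists_abs_zolotarevWeight_le {β : ℝ} (hβ : β ∈ Ioo (0 : ℝ) 1) (c : ℝ) :
    ∃ C : ℝ, 0 ≤ C ∧ ∀ x : ℝ, 0 < x → |zolotarevWeight β x| ≤ C * Real.exp (-(c * x)) := by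
  have hc := rayCos_pos hβ
  -- The contour is pushed so far to the right that its decay rate c R^β / 2 exceeds the prescribed
  -- one.
  obtain ⟨R, hR1, hR⟩ : ∃ R : ℝ, 1 ≤ R ∧ c ≤ rayCos β * R ^ β / 2 := by
    have h : Tendsto (fun R : ℝ => R ^ β) atTop atTop := tendsto_rpow_atTop hβ.1
    obtain ⟨R, h1, h2⟩ := ((eventually_ge_atTop (1 : ℝ)).and
      (h.eventually_ge_atTop (2 * c / rayCos β))).exists
    refine ⟨R, h1, ?_⟩
    rw [div_le_iff₀ hc] at h2
    linarith
  set J := ∫ p in Ioi (0 : ℝ), (1 + ‖p‖ ^ 2) ^ (-(-(β - 2)) / 2) with hJ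
  have hJ0 : 0 ≤ J := by apply integral_nonneg; intro p; positivity
  refine ⟨β * (Real.pi⁻¹ * ((1 + 2 / rayCos β) * Real.exp R * J)),
    by have := hβ.1; positivity, fun x hx => ?_⟩
  rw [zolotarevWeight_eq hβ hx hR1, abs_mul, abs_mul, abs_of_pos hβ.1,
    abs_of_pos (inv_pos.2 Real.pi_pos)]
  have h1 : |(∫ p in Ioi (0 : ℝ), stableKernel β x (vline R p)).re| ≤
      (1 + 2 / rayCos β) * Real.exp R * Real.exp (-(rayCos β * R ^ β / 2) * x) * J := by
    refine (Complex.abs_re_le_norm _).trans ?_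
    rw [hJ, ← integral_const_mul]
    exact norm_integral_le_of_norm_le ((integrable_one_add_sq_rpow
      (by linarith [hβ.2])).integrableOn.const_mul _)
      (Eventually.of_forall fun p => norm_stableKernel_le hβ hx.le hR1 p)
  have h2 : Real.exp (-(rayCos β * R ^ β / 2) * x) ≤ Real.exp (-(c * x)) := by
    apply Real.exp_le_exp.2
    nlinarith
  have hb := hβ.1
  have hpi := Real.pi_pos
  calc _ ≤ β * (Real.pi⁻¹ * ((1 + 2 / rayCos β) * Real.exp R *
        Real.exp (-(rayCos β * R ^ β / 2) * x) * J)) := by gcongr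
    _ ≤ β * (Real.pi⁻¹ * ((1 + 2 / rayCos β) * Real.exp R * Real.exp (-(c * x)) * J)) := by
        gcongr
    _ = _ := by ring

lemma measurable_zolotarevWeight (β : ℝ) : Measurable (zolotarevWeight β) := by
  have h : StronglyMeasurable (stableDensity β 1) := by
    unfold stableDensity
    refine StronglyMeasurable.const_mul ?_ _
    apply Complex.continuous_re.comp_stronglyMeasurable
    apply StronglyMeasurable.integral_prod_right
    apply Measurable.stronglyMeasurable
    unfold Function.uncurry
    fun_prop
  unfold zolotarevWeight
  have h2 := h.measurable
  fun_prop

/-- Normalization of the Zolotarev weight. -/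
lemma integral_zolotarevWeight {β : ℝ} (hβ : β ∈ Ioo (0 : ℝ) 1) :
    (1 / β) * ∫ x in Ioi (0 : ℝ), zolotarevWeight β x = 1 := by
  have hc := rayCos_pos hβ
  have e1 : ∫ x in Ioi (0 : ℝ), zolotarevWeight β x =
      β * (Real.pi⁻¹ * ∫ x in Ioi (0 : ℝ),
        (∫ p in Ioi (0 : ℝ), stableKernel β x (vline 1 p)).re) := by
    rw [← integral_const_mul, ← integral_const_mul]
    exact setIntegral_congr_fun measurableSet_Ioi fun x hx => zolotarevWeight_eq hβ hx le_rfl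
  have hint : Integrable (Function.uncurry fun x p : ℝ => stableKernel β x (vline 1 p))
      ((volume.restrict (Ioi 0)).prod (volume.restrict (Ioi 0))) := by
    have i1 : IntegrableOn (fun x : ℝ => (1 + 2 / rayCos β) * Real.exp 1 *
        Real.exp (-(rayCos β * 1 ^ β / 2) * x)) (Ioi 0) := by
      have : 0 < rayCos β * 1 ^ β / 2 := by rw [Real.one_rpow]; positivity
      exact (exp_neg_integrableOn_Ioi 0 this).const_mul _
    refine (i1.mul_prod (integrable_one_add_sq_rpow (e := β - 2)
      (by linarith [hβ.2])).integrableOn).mono' ?_ ?_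
    · exact (continuous_stableKernel_uncurry one_pos).aestronglyMeasurable
    · rw [Measure.prod_restrict]
      filter_upwards [ae_restrict_mem (measurableSet_Ioi.prod measurableSet_Ioi)] with q hq
      exact norm_stableKernel_le hβ (le_of_lt hq.1) le_rfl q.2
  have e2 : ∫ x in Ioi (0 : ℝ), (∫ p in Ioi (0 : ℝ), stableKernel β x (vline 1 p)).re =
      Real.pi := by
    have a := integral_re (𝕜 := ℂ) hint.integral_prod_left
    simp only [Function.uncurry_apply_pair, RCLike.re_eq_complex_re] at a
    rw [a, integral_integral_swap hint, ← re_integral_vline_inv_sq_mul_exp]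
    congr 1
    apply setIntegral_congr_fun measurableSet_Ioi
    intro p _
    have hs : 0 < (vline 1 p).re := by simp
    have hs0 : vline 1 p ≠ 0 := by intro h; rw [h] at hs; simp at hs
    have hz : 0 < (vline 1 p ^ (β : ℂ)).re := by
      refine lt_of_lt_of_le ?_ (rayCos_mul_le_re_cpow hβ hs.le)
      have := norm_pos_iff.2 hs0
      positivity
    -- With z = s^β the inner x-integral is (1 - β + β)/z = s^{-β}, so s^{β-2} e^s becomes s⁻² e^s.
    have b := integral_affine_mul_exp_neg (1 - β : ℂ) β _ hz
    have b2 : ∀ x : ℝ, stableKernel β x (vline 1 p) =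
        vline 1 p ^ ((β : ℂ) - 2) * Complex.exp (vline 1 p) *
        (((1 - β : ℂ) + β * x * vline 1 p ^ (β : ℂ)) *
          Complex.exp (-(x * vline 1 p ^ (β : ℂ)))) := by
      intro x
      rw [stableKernel, stableExp, sub_eq_add_neg (vline 1 p), Complex.exp_add]
      ring
    simp_rw [b2]
    rw [integral_const_mul, b, Complex.cpow_sub _ _ hs0, Complex.cpow_ofNat]
    have hz0 : vline 1 p ^ (β : ℂ) ≠ 0 := by intro h; rw [h] at hz; simp at hz
    field_simp
    ring
  rw [e1, e2]
  have := hβ.1.ne'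
  field_simp

/-! ### The operators E_β(Aτ) and E_β'(Aτ) -/

section Joint

variable {X Y : Type*} [NormedAddCommGroup X] [NormedAddCommGroup Y]

/-- A strongly continuous, locally bounded family of additive maps is jointly continuous. -/
lemma continuousOn_uncurry_of_bound {s : Set ℝ} {f : ℝ → Y → X} {c : ℝ → ℝ}
    (hsub : ∀ t ∈ s, ∀ y y', f t (y - y') = f t y - f t y')
    (hc : ContinuousOn c s) (hb : ∀ t ∈ s, ∀ y, ‖f t y‖ ≤ c t * ‖y‖)
    (hf : ∀ y, ContinuousOn (fun t => f t y) s) :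
    ContinuousOn (fun q : ℝ × Y => f q.1 q.2) (s ×ˢ univ) := by
  rintro ⟨t₀, y₀⟩ ⟨ht₀, -⟩
  have hfst : Tendsto (Prod.fst : ℝ × Y → ℝ) (𝓝[s ×ˢ univ] (t₀, y₀)) (𝓝[s] t₀) := by
    apply tendsto_nhdsWithin_of_tendsto_nhds_of_eventually_within
    · exact continuous_fst.continuousWithinAt
    · filter_upwards [self_mem_nhdsWithin] with q hq using hq.1
  have h1 : Tendsto (fun q : ℝ × Y => c q.1 * ‖q.2 - y₀‖) (𝓝[s ×ˢ univ] (t₀, y₀)) (𝓝 0) := by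
    have a : Tendsto (fun q : ℝ × Y => ‖q.2 - y₀‖) (𝓝[s ×ˢ univ] (t₀, y₀)) (𝓝 0) := by
      have : Continuous fun q : ℝ × Y => ‖q.2 - y₀‖ := by fun_prop
      simpa using (this.tendsto (t₀, y₀)).mono_left nhdsWithin_le_nhds
    simpa using ((hc t₀ ht₀).tendsto.comp hfst).mul a
  have h2 : Tendsto (fun q : ℝ × Y => f q.1 (q.2 - y₀)) (𝓝[s ×ˢ univ] (t₀, y₀)) (𝓝 0) := by
    apply squeeze_zero_norm' _ h1
    filter_upwards [self_mem_nhdsWithin] with q hq using hb _ hq.1 _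
  have h3 := h2.add ((hf y₀ t₀ ht₀).tendsto.comp hfst)
  rw [zero_add] at h3
  refine h3.congr' ?_
  filter_upwards [self_mem_nhdsWithin] with q hq
  simp [hsub _ hq.1]

end Joint

section MittagLeffler

variable {X : Type*} [NormedAddCommGroup X] [NormedSpace ℝ X]

lemma mittagLefflerIntegrand_eq (S : ℝ → X →L[ℝ] X) (β τ : ℝ) (y : X) (x : ℝ) :
    mittagLefflerIntegrand S β τ y x = zolotarevWeight β x • S (τ * x) y := rfl

lemma mittagLefflerDerivIntegrand_eq (S : ℝ → X →L[ℝ] X) (β τ : ℝ) (y : X) {x : ℝ} (hx : 0 < x) :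
    mittagLefflerDerivIntegrand S β τ y x = (x * zolotarevWeight β x) • S (τ * x) y := by
  have : x ^ (-1 / β) = x * x ^ (-1 - 1 / β) := by
    have h := Real.rpow_add hx 1 (-1 - 1 / β)
    rw [Real.rpow_one] at h
    rw [← h]
    ring_nf
  rw [mittagLefflerDerivIntegrand, zolotarevWeight, ← mul_assoc, ← this]

variable {S : ℝ → X →L[ℝ] X} {M m : ℝ}

lemma IsC0Semigroup.aestronglyMeasurable_comp_mul (hS : IsC0Semigroup S) {τ : ℝ} (hτ : 0 ≤ τ)
    (y : X) : AEStronglyMeasurable (fun x => S (τ * x) y) (volume.restrict (Ioi 0)) := by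
  apply ContinuousOn.aestronglyMeasurable _ measurableSet_Ioi
  exact (hS.continuousOn y).comp (by fun_prop) fun x hx => mul_nonneg hτ (le_of_lt hx)

/-- The decay rate mΘ + 1 of the weight pays for the growth e^{mτx} of the semigroup for all τ ≤ Θ
and leaves e^{-x}. -/
lemma norm_mittagLefflerIntegrand_le (hM : 0 ≤ M) (hm : 0 ≤ m)
    (hb : ∀ t : ℝ, 0 ≤ t → ‖S t‖ ≤ M * Real.exp (m * t)) {β C Θ : ℝ}
    (hC : ∀ x : ℝ, 0 < x → |zolotarevWeight β x| ≤ C * Real.exp (-((m * Θ + 1) * x)))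
    {τ : ℝ} (hτ : τ ∈ Icc 0 Θ) (y : X) {x : ℝ} (hx : 0 < x) :
    ‖mittagLefflerIntegrand S β τ y x‖ ≤ C * M * ‖y‖ * Real.exp (-x) := by
  rw [mittagLefflerIntegrand_eq, norm_smul, Real.norm_eq_abs]
  have h1 : ‖S (τ * x) y‖ ≤ M * Real.exp (m * Θ * x) * ‖y‖ := by
    refine (ContinuousLinearMap.le_of_opNorm_le _ (hb _ (mul_nonneg hτ.1 hx.le)) y).trans ?_
    gcongr M * Real.exp ?_ * _
    have := mul_le_mul_of_nonneg_right hτ.2 hx.le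
    nlinarith
  have h0 := hC x hx
  have hC0 : 0 ≤ C * Real.exp (-((m * Θ + 1) * x)) := (abs_nonneg _).trans h0
  calc _ ≤ C * Real.exp (-((m * Θ + 1) * x)) * (M * Real.exp (m * Θ * x) * ‖y‖) := by gcongr
    _ = C * M * ‖y‖ * (Real.exp (-((m * Θ + 1) * x)) * Real.exp (m * Θ * x)) := by ring
    _ = _ := by rw [← Real.exp_add]; ring_nf

lemma integrableOn_mittagLefflerIntegrand (hS : IsC0Semigroup S) (hM : 0 ≤ M) (hm : 0 ≤ m)
    (hb : ∀ t : ℝ, 0 ≤ t → ‖S t‖ ≤ M * Real.exp (m * t)) {β : ℝ} (hβ : β ∈ Ioo (0 : ℝ) 1)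
    {τ : ℝ} (hτ : 0 ≤ τ) (y : X) :
    IntegrableOn (mittagLefflerIntegrand S β τ y) (Ioi 0) ∧
      IntegrableOn (mittagLefflerDerivIntegrand S β τ y) (Ioi 0) := by
  obtain ⟨C, hC0, hC⟩ := exists_abs_zolotarevWeight_le hβ (m * τ + 1)
  have hle : ∀ x : ℝ, 0 < x → _ := fun x hx =>
    norm_mittagLefflerIntegrand_le hM hm hb hC ⟨hτ, le_rfl⟩ y hx
  have hmeas := (measurable_zolotarevWeight β).aestronglyMeasurable
    (μ := volume.restrict (Ioi (0 : ℝ)))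
  constructor
  · refine Integrable.mono' ((integrableOn_exp_neg_Ioi 0).const_mul (C * M * ‖y‖)) ?_ ?_
    · exact hmeas.smul (hS.aestronglyMeasurable_comp_mul hτ y)
    · filter_upwards [ae_restrict_mem measurableSet_Ioi] with x hx using hle x hx
  · have hg : IntegrableOn (fun x : ℝ => Real.exp (-x) * x) (Ioi 0) := by
      have h := Real.GammaIntegral_convergent (s := 2) (by norm_num)
      norm_num at h
      exact h
    have : IntegrableOn (fun x : ℝ => (x * zolotarevWeight β x) • S (τ * x) y) (Ioi 0) := by
      refine Integrable.mono' (hg.const_mul (C * M * ‖y‖)) ?_ ?_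
      · exact (measurable_id.aestronglyMeasurable.mul hmeas).smul
          (hS.aestronglyMeasurable_comp_mul hτ y)
      · filter_upwards [ae_restrict_mem measurableSet_Ioi] with x hx
        have hx' : 0 < x := hx
        rw [mul_smul, ← mittagLefflerIntegrand_eq, norm_smul, Real.norm_eq_abs, abs_of_pos hx']
        have := mul_le_mul_of_nonneg_left (hle x hx) hx'.le
        linarith
    exact this.congr_fun (fun x hx => (mittagLefflerDerivIntegrand_eq S β τ y hx).symm)
      measurableSet_Ioi

lemma norm_mittagLefflerOp_le (hM : 0 ≤ M) (hm : 0 ≤ m)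
    (hb : ∀ t : ℝ, 0 ≤ t → ‖S t‖ ≤ M * Real.exp (m * t)) {β C Θ : ℝ} (hβ : 0 < β)
    (hC : ∀ x : ℝ, 0 < x → |zolotarevWeight β x| ≤ C * Real.exp (-((m * Θ + 1) * x)))
    {τ : ℝ} (hτ : τ ∈ Icc 0 Θ) (y : X) :
    ‖mittagLefflerOp S β τ y‖ ≤ 1 / β * (C * M) * ‖y‖ := by
  rw [mittagLefflerOp, norm_smul, Real.norm_eq_abs, abs_of_pos (by positivity), mul_assoc]
  gcongr
  have h := norm_integral_le_of_norm_le ((integrableOn_exp_neg_Ioi 0).const_mul (C * M * ‖y‖))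
    ((ae_restrict_mem measurableSet_Ioi).mono fun x hx =>
      norm_mittagLefflerIntegrand_le hM hm hb hC hτ y hx)
  rwa [integral_const_mul, integral_exp_neg_Ioi_zero, mul_one] at h

lemma continuousOn_mittagLefflerOp (hS : IsC0Semigroup S) (hM : 0 ≤ M) (hm : 0 ≤ m)
    (hb : ∀ t : ℝ, 0 ≤ t → ‖S t‖ ≤ M * Real.exp (m * t)) {β Θ : ℝ} (hβ : β ∈ Ioo (0 : ℝ) 1)
    (y : X) : ContinuousOn (fun τ => mittagLefflerOp S β τ y) (Icc 0 Θ) := by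
  obtain ⟨C, hC0, hC⟩ := exists_abs_zolotarevWeight_le hβ (m * Θ + 1)
  refine ContinuousOn.const_smul ?_ (1 / β)
  refine continuousOn_of_dominated (bound := fun x => C * M * ‖y‖ * Real.exp (-x)) ?_ ?_
    ((integrableOn_exp_neg_Ioi 0).const_mul (C * M * ‖y‖)) ?_
  · intro τ hτ
    exact (integrableOn_mittagLefflerIntegrand hS hM hm hb hβ hτ.1 y).1.aestronglyMeasurable
  · intro τ hτ
    filter_upwards [ae_restrict_mem measurableSet_Ioi] with x hx using
      norm_mittagLefflerIntegrand_le hM hm hb hC hτ y hx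
  · filter_upwards [ae_restrict_mem measurableSet_Ioi] with x hx
    simp only [mittagLefflerIntegrand_eq]
    refine ContinuousOn.const_smul ?_ _
    exact (hS.continuousOn y).comp (by fun_prop) fun τ hτ => mul_nonneg hτ.1 (le_of_lt hx)

lemma mittagLefflerOp_zero [CompleteSpace X] (hS : IsC0Semigroup S) {β : ℝ}
    (hβ : β ∈ Ioo (0 : ℝ) 1) (y : X) : mittagLefflerOp S β 0 y = y := by
  simp only [mittagLefflerOp, mittagLefflerIntegrand_eq, zero_mul, hS.map_zero,
    ContinuousLinearMap.id_apply]
  rw [integral_smul_const, smul_smul, integral_zolotarevWeight hβ, one_smul]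

lemma mittagLefflerOp_sub (hS : IsC0Semigroup S) (hM : 0 ≤ M) (hm : 0 ≤ m)
    (hb : ∀ t : ℝ, 0 ≤ t → ‖S t‖ ≤ M * Real.exp (m * t)) {β : ℝ} (hβ : β ∈ Ioo (0 : ℝ) 1)
    {τ : ℝ} (hτ : 0 ≤ τ) (y y' : X) :
    mittagLefflerOp S β τ (y - y') = mittagLefflerOp S β τ y - mittagLefflerOp S β τ y' := by
  simp only [mittagLefflerOp]
  rw [← smul_sub, ← integral_sub (integrableOn_mittagLefflerIntegrand hS hM hm hb hβ hτ y).1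
    (integrableOn_mittagLefflerIntegrand hS hM hm hb hβ hτ y').1]
  simp only [mittagLefflerIntegrand_eq, map_sub, smul_sub]

end MittagLeffler

/-! ### Smoothing: E_β'(Aτ) as a map from B to B₁ -/

section Smoothing

variable {B₁ B : Type*} [NormedAddCommGroup B₁] [NormedSpace ℝ B₁] [NormedAddCommGroup B]
  [NormedSpace ℝ B]

/-- A semigroup `S` on `B` with a restriction `S₁` to a continuously embedded subspace `B₁` and a
smoothing bound from `B` to `B₁`. -/
structure SmoothingSemigroup (i : B₁ →L[ℝ] B) (S : ℝ → B →L[ℝ] B) (S₁ : ℝ → B₁ →L[ℝ] B₁)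
    (M m M₁ m₁ κ ω : ℝ) : Prop where
  injective : Function.Injective i
  semigroup : IsC0Semigroup S
  semigroup₁ : IsC0Semigroup S₁
  comm : ∀ t : ℝ, 0 ≤ t → ∀ b : B₁, i (S₁ t b) = S t (i b)
  M_nonneg : 0 ≤ M
  m_nonneg : 0 ≤ m
  norm_le : ∀ t : ℝ, 0 ≤ t → ‖S t‖ ≤ M * Real.exp (m * t)
  M₁_nonneg : 0 ≤ M₁
  m₁_nonneg : 0 ≤ m₁
  norm₁_le : ∀ t : ℝ, 0 ≤ t → ‖S₁ t‖ ≤ M₁ * Real.exp (m₁ * t)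
  maps : ∀ t : ℝ, 0 < t → ∀ b : B, ∃ c : B₁, i c = S t b
  bound : ∀ t : ℝ, 0 < t → t ≤ 1 → ∀ (b : B) (c : B₁), i c = S t b →
    ‖c‖ ≤ κ * t ^ (-ω) * ‖b‖
  κ_pos : 0 < κ
  ω_mem : ω ∈ Ioo (0 : ℝ) 1

/-- The operator `e^{At}`, `t > 0`, as a map from `B` to `B₁`. -/
def smoothLift (i : B₁ →L[ℝ] B) (S : ℝ → B →L[ℝ] B) (t : ℝ) (y : B) : B₁ :=
  Function.invFun i (S t y)

namespace SmoothingSemigroup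

variable {i : B₁ →L[ℝ] B} {S : ℝ → B →L[ℝ] B} {S₁ : ℝ → B₁ →L[ℝ] B₁} {M m M₁ m₁ κ ω : ℝ}

lemma map_smoothLift (hS : SmoothingSemigroup i S S₁ M m M₁ m₁ κ ω) {t : ℝ} (ht : 0 < t) (y : B) :
    i (smoothLift i S t y) = S t y :=
  Function.invFun_eq (hS.maps t ht y)

lemma smoothLift_sub (hS : SmoothingSemigroup i S S₁ M m M₁ m₁ κ ω) {t : ℝ} (ht : 0 < t)
    (y y' : B) :
    smoothLift i S t (y - y') = smoothLift i S t y - smoothLift i S t y' := by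
  apply hS.injective
  simp only [map_sub, hS.map_smoothLift ht]

lemma smoothLift_add (hS : SmoothingSemigroup i S S₁ M m M₁ m₁ κ ω) {s t : ℝ} (hs : 0 ≤ s)
    (ht : 0 < t) (y : B) :
    smoothLift i S (s + t) y = S₁ s (smoothLift i S t y) := by
  apply hS.injective
  rw [hS.map_smoothLift (by positivity), hS.comm s hs, hS.map_smoothLift ht,
    hS.semigroup.map_add s t hs ht.le, ContinuousLinearMap.comp_apply]

/-- For t ≤ 1 this is the smoothing hypothesis; for t ≥ 1 write e^{At} = e^{A(t-1)} e^A and use the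
growth bound in B₁. The rate m₁ + 1 instead of m₁ keeps the factor t^{-ω} for large t, as t^ω ≤ e^t.
-/
lemma norm_smoothLift_le (hS : SmoothingSemigroup i S S₁ M m M₁ m₁ κ ω) {t : ℝ} (ht : 0 < t)
    (y : B) :
    ‖smoothLift i S t y‖ ≤ κ * (1 + M₁) * t ^ (-ω) * Real.exp ((m₁ + 1) * t) * ‖y‖ := by
  have hκ := hS.κ_pos
  have hM₁ := hS.M₁_nonneg
  have hm₁ := hS.m₁_nonneg
  have hω := hS.ω_mem
  rcases le_total t 1 with h | h
  · refine (hS.bound t ht h y _ (hS.map_smoothLift ht y)).trans ?_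
    have h1 : 1 ≤ Real.exp ((m₁ + 1) * t) := Real.one_le_exp (by positivity)
    have h2 : (1 : ℝ) ≤ (1 + M₁) * Real.exp ((m₁ + 1) * t) := by nlinarith
    have h3 : 0 ≤ κ * t ^ (-ω) * ‖y‖ := by positivity
    nlinarith
  · have e : smoothLift i S t y = S₁ (t - 1) (smoothLift i S 1 y) := by
      rw [← hS.smoothLift_add (by linarith) one_pos]; ring_nf
    have h1 := hS.bound 1 one_pos le_rfl y _ (hS.map_smoothLift one_pos y)
    rw [Real.one_rpow, mul_one] at h1
    have h2 := ContinuousLinearMap.le_of_opNorm_le _ (hS.norm₁_le (t - 1) (by linarith))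
      (smoothLift i S 1 y)
    have h3 : Real.exp (m₁ * (t - 1)) ≤ t ^ (-ω) * Real.exp ((m₁ + 1) * t) := by
      have a1 : t ^ ω ≤ Real.exp t := by
        calc t ^ ω ≤ t ^ (1 : ℝ) := Real.rpow_le_rpow_of_exponent_le h hω.2.le
          _ ≤ Real.exp t := by rw [Real.rpow_one]; linarith [Real.add_one_le_exp t]
      have a2 : 1 ≤ t ^ (-ω) * Real.exp t := by
        rw [Real.rpow_neg ht.le, ← div_eq_inv_mul, le_div_iff₀ (by positivity), one_mul]
        exact a1
      calc Real.exp (m₁ * (t - 1)) ≤ Real.exp (m₁ * t) * 1 := by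
            rw [mul_one]; apply Real.exp_le_exp.2; nlinarith
        _ ≤ Real.exp (m₁ * t) * (t ^ (-ω) * Real.exp t) := by gcongr
        _ = t ^ (-ω) * (Real.exp (m₁ * t) * Real.exp t) := by ring
        _ = _ := by rw [← Real.exp_add]; ring_nf
    rw [e]
    calc _ ≤ M₁ * Real.exp (m₁ * (t - 1)) * (κ * ‖y‖) := h2.trans (by gcongr)
      _ ≤ (1 + M₁) * (t ^ (-ω) * Real.exp ((m₁ + 1) * t)) * (κ * ‖y‖) := by
          gcongr; linarith
      _ = _ := by ring

/-- Near t the lift at time s is e^{A(s-t/2)} applied to the fixed element e^{At/2} y of B₁, so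
strong continuity in B₁ suffices. -/
lemma continuousOn_smoothLift (hS : SmoothingSemigroup i S S₁ M m M₁ m₁ κ ω) (y : B) :
    ContinuousOn (fun t => smoothLift i S t y) (Ioi 0) := by
  intro t ht
  apply ContinuousAt.continuousWithinAt
  have ht' : 0 < t := ht
  have h1 : ContinuousAt (fun s => S₁ (s - t / 2) (smoothLift i S (t / 2) y)) t := by
    have := (hS.semigroup₁.continuousOn (smoothLift i S (t / 2) y)).continuousAt
      (x := t - t / 2) (Ici_mem_nhds (by linarith))
    exact ContinuousAt.comp (f := fun s => s - t / 2) this (by fun_prop)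
  refine h1.congr ?_
  filter_upwards [Ioi_mem_nhds (show t / 2 < t by linarith)] with s hs
  have hs' : t / 2 < s := hs
  rw [← hS.smoothLift_add (by linarith) (by linarith)]
  ring_nf

lemma aestronglyMeasurable_smoothIntegrand (hS : SmoothingSemigroup i S S₁ M m M₁ m₁ κ ω)
    (β : ℝ) {τ : ℝ} (hτ : 0 < τ) (y : B) :
    AEStronglyMeasurable (fun x => (x * zolotarevWeight β x) • smoothLift i S (τ * x) y)
      (volume.restrict (Ioi 0)) := by
  refine (measurable_id.mul (measurable_zolotarevWeight β)).aestronglyMeasurable.smul ?_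
  apply ContinuousOn.aestronglyMeasurable _ measurableSet_Ioi
  exact (hS.continuousOn_smoothLift y).comp (by fun_prop) fun x hx => mul_pos hτ hx

/-- The extra factor x in E_β' meets x^{-ω} from smoothing, which gives e^{-x} x^{1-ω}, the
integrand of Γ(2 - ω). -/
lemma norm_smoothIntegrand_le (hS : SmoothingSemigroup i S S₁ M m M₁ m₁ κ ω) {β C Θ : ℝ}
    (hC : ∀ x : ℝ, 0 < x → |zolotarevWeight β x| ≤ C * Real.exp (-(((m₁ + 1) * Θ + 1) * x)))
    {τ : ℝ} (hτ : τ ∈ Ioc 0 Θ) (y : B) {x : ℝ} (hx : 0 < x) :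
    ‖(x * zolotarevWeight β x) • smoothLift i S (τ * x) y‖ ≤
      C * (κ * (1 + M₁)) * τ ^ (-ω) * ‖y‖ * (Real.exp (-x) * x ^ (1 - ω)) := by
  have hκ := hS.κ_pos
  have hM₁ := hS.M₁_nonneg
  have hm₁ := hS.m₁_nonneg
  have hτ0 := hτ.1
  have h0 := hC x hx
  have hC0 : 0 ≤ C * Real.exp (-(((m₁ + 1) * Θ + 1) * x)) := (abs_nonneg _).trans h0
  have h1 := hS.norm_smoothLift_le (mul_pos hτ0 hx) y
  have h2 : Real.exp ((m₁ + 1) * (τ * x)) ≤ Real.exp ((m₁ + 1) * Θ * x) := by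
    apply Real.exp_le_exp.2
    have := mul_le_mul_of_nonneg_right hτ.2 hx.le
    nlinarith
  rw [norm_smul, Real.norm_eq_abs, abs_mul, abs_of_pos hx]
  calc _ ≤ x * (C * Real.exp (-(((m₁ + 1) * Θ + 1) * x))) *
        (κ * (1 + M₁) * (τ * x) ^ (-ω) * Real.exp ((m₁ + 1) * Θ * x) * ‖y‖) := by
        refine mul_le_mul (by gcongr) (h1.trans (by gcongr)) (norm_nonneg _) (by positivity)
    _ = C * (κ * (1 + M₁)) * τ ^ (-ω) * ‖y‖ *
        ((Real.exp (-(((m₁ + 1) * Θ + 1) * x)) * Real.exp ((m₁ + 1) * Θ * x)) *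
          (x * x ^ (-ω))) := by
        rw [Real.mul_rpow hτ0.le hx.le]; ring
    _ = _ := by
        rw [← Real.exp_add, sub_eq_add_neg 1 ω, Real.rpow_add hx, Real.rpow_one]
        ring_nf

lemma integrableOn_exp_neg_mul_rpow_one_sub (hS : SmoothingSemigroup i S S₁ M m M₁ m₁ κ ω) :
    IntegrableOn (fun x : ℝ => Real.exp (-x) * x ^ (1 - ω)) (Ioi 0) := by
  have h := Real.GammaIntegral_convergent (s := 2 - ω) (by linarith [hS.ω_mem.2])
  rwa [show 2 - ω - 1 = 1 - ω by ring] at h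

lemma integrableOn_smoothIntegrand (hS : SmoothingSemigroup i S S₁ M m M₁ m₁ κ ω) {β : ℝ}
    (hβ : β ∈ Ioo (0 : ℝ) 1) {τ : ℝ} (hτ : 0 < τ) (y : B) :
    IntegrableOn (fun x => (x * zolotarevWeight β x) • smoothLift i S (τ * x) y) (Ioi 0) := by
  obtain ⟨C, hC0, hC⟩ := exists_abs_zolotarevWeight_le hβ ((m₁ + 1) * τ + 1)
  exact (hS.integrableOn_exp_neg_mul_rpow_one_sub.const_mul _).mono'
    (hS.aestronglyMeasurable_smoothIntegrand β hτ y)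
    ((ae_restrict_mem measurableSet_Ioi).mono fun x hx =>
      hS.norm_smoothIntegrand_le hC ⟨hτ, le_rfl⟩ y hx)

end SmoothingSemigroup

/-- The operator `E_β'(Aτ)`, `τ > 0`, as a map from `B` to `B₁`. -/
def smoothDerivOp (i : B₁ →L[ℝ] B) (S : ℝ → B →L[ℝ] B) (β τ : ℝ) (y : B) : B₁ :=
  (1 / β) • ∫ x in Ioi (0 : ℝ), (x * zolotarevWeight β x) • smoothLift i S (τ * x) y

namespace SmoothingSemigroup

variable {i : B₁ →L[ℝ] B} {S : ℝ → B →L[ℝ] B} {S₁ : ℝ → B₁ →L[ℝ] B₁} {M m M₁ m₁ κ ω : ℝ}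

lemma map_smoothDerivOp [CompleteSpace B₁] [CompleteSpace B]
    (hS : SmoothingSemigroup i S S₁ M m M₁ m₁ κ ω) {β : ℝ}
    (hβ : β ∈ Ioo (0 : ℝ) 1) {τ : ℝ} (hτ : 0 < τ) (y : B) :
    i (smoothDerivOp i S β τ y) = mittagLefflerDerivOp S β τ y := by
  rw [smoothDerivOp, mittagLefflerDerivOp, map_smul,
    ← i.integral_comp_comm (hS.integrableOn_smoothIntegrand hβ hτ y)]
  congr 1
  apply setIntegral_congr_fun measurableSet_Ioi
  intro x hx
  simp only [map_smul]
  rw [hS.map_smoothLift (mul_pos hτ hx), mittagLefflerDerivIntegrand_eq S β τ y hx]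

lemma smoothDerivOp_sub (hS : SmoothingSemigroup i S S₁ M m M₁ m₁ κ ω) {β : ℝ}
    (hβ : β ∈ Ioo (0 : ℝ) 1) {τ : ℝ} (hτ : 0 < τ) (y y' : B) :
    smoothDerivOp i S β τ (y - y') = smoothDerivOp i S β τ y - smoothDerivOp i S β τ y' := by
  simp only [smoothDerivOp]
  rw [← smul_sub, ← integral_sub (hS.integrableOn_smoothIntegrand hβ hτ y)
    (hS.integrableOn_smoothIntegrand hβ hτ y')]
  congr 1
  apply setIntegral_congr_fun measurableSet_Ioi
  intro x hx
  simp only [hS.smoothLift_sub (mul_pos hτ hx), smul_sub]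

lemma norm_smoothDerivOp_le (hS : SmoothingSemigroup i S S₁ M m M₁ m₁ κ ω) {β C Θ : ℝ}
    (hβ : 0 < β)
    (hC : ∀ x : ℝ, 0 < x → |zolotarevWeight β x| ≤ C * Real.exp (-(((m₁ + 1) * Θ + 1) * x)))
    {τ : ℝ} (hτ : τ ∈ Ioc 0 Θ) (y : B) :
    ‖smoothDerivOp i S β τ y‖ ≤
      1 / β * (C * (κ * (1 + M₁)) * Real.Gamma (2 - ω)) * τ ^ (-ω) * ‖y‖ := by
  have h := norm_integral_le_of_norm_le (hS.integrableOn_exp_neg_mul_rpow_one_sub.const_mul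
    (C * (κ * (1 + M₁)) * τ ^ (-ω) * ‖y‖)) ((ae_restrict_mem measurableSet_Ioi).mono fun x hx =>
      hS.norm_smoothIntegrand_le hC hτ y hx)
  rw [integral_const_mul] at h
  rw [smoothDerivOp, norm_smul, Real.norm_eq_abs, abs_of_pos (by positivity),
    Real.Gamma_eq_integral (by linarith [hS.ω_mem.2]), show 2 - ω - 1 = 1 - ω by ring]
  refine (mul_le_mul_of_nonneg_left h (by positivity : 0 ≤ 1 / β)).trans (le_of_eq ?_)
  ring

lemma continuousOn_smoothDerivOp (hS : SmoothingSemigroup i S S₁ M m M₁ m₁ κ ω) {β : ℝ}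
    (hβ : β ∈ Ioo (0 : ℝ) 1) (y : B) :
    ContinuousOn (fun τ => smoothDerivOp i S β τ y) (Ioi 0) := by
  refine ContinuousOn.const_smul ?_ (1 / β)
  intro τ₀ hτ₀
  have hτ₀' : 0 < τ₀ := hτ₀
  apply ContinuousAt.continuousWithinAt
  -- A single dominating function is needed near τ₀: the decay rate is fixed for τ ≤ 2τ₀, and τ ≥
  -- τ₀/2 keeps τ^{-ω} bounded.
  obtain ⟨C, hC0, hC⟩ := exists_abs_zolotarevWeight_le hβ ((m₁ + 1) * (2 * τ₀) + 1)
  have hκ := hS.κ_pos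
  have hM₁ := hS.M₁_nonneg
  have hn : Ioo (τ₀ / 2) (2 * τ₀) ∈ 𝓝 τ₀ := Ioo_mem_nhds (by linarith) (by linarith)
  refine continuousAt_of_dominated
    (bound := fun x => C * (κ * (1 + M₁)) * (τ₀ / 2) ^ (-ω) * ‖y‖ *
      (Real.exp (-x) * x ^ (1 - ω))) ?_ ?_
    (hS.integrableOn_exp_neg_mul_rpow_one_sub.const_mul _) ?_
  · filter_upwards [hn] with τ hτ
    exact hS.aestronglyMeasurable_smoothIntegrand β (by linarith [hτ.1]) y
  · filter_upwards [hn] with τ hτ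
    filter_upwards [ae_restrict_mem measurableSet_Ioi] with x hx
    have hx' : 0 < x := hx
    refine (hS.norm_smoothIntegrand_le hC ⟨by linarith [hτ.1], hτ.2.le⟩ y hx).trans ?_
    gcongr ?_ * _ * _
    have : τ ^ (-ω) ≤ (τ₀ / 2) ^ (-ω) :=
      Real.rpow_le_rpow_of_nonpos (by linarith) hτ.1.le (by linarith [hS.ω_mem.1])
    gcongr
  · filter_upwards [ae_restrict_mem measurableSet_Ioi] with x hx
    refine ContinuousAt.const_smul ?_ _
    have := (hS.continuousOn_smoothLift y).continuousAt (Ioi_mem_nhds (mul_pos hτ₀' hx))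
    exact ContinuousAt.comp (f := fun τ => τ * x) this (by fun_prop)

lemma map_mittagLefflerOp [CompleteSpace B₁] [CompleteSpace B]
    (hS : SmoothingSemigroup i S S₁ M m M₁ m₁ κ ω) {β : ℝ} (hβ : β ∈ Ioo (0 : ℝ) 1)
    {τ : ℝ} (hτ : 0 ≤ τ) (Y : B₁) :
    i (mittagLefflerOp S₁ β τ Y) = mittagLefflerOp S β τ (i Y) := by
  rw [mittagLefflerOp, mittagLefflerOp, map_smul,
    ← i.integral_comp_comm (integrableOn_mittagLefflerIntegrand hS.semigroup₁ hS.M₁_nonneg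
      hS.m₁_nonneg hS.norm₁_le hβ hτ Y).1]
  congr 1
  apply setIntegral_congr_fun measurableSet_Ioi
  intro x hx
  simp only [mittagLefflerIntegrand_eq, map_smul, hS.comm _ (mul_nonneg hτ (le_of_lt hx))]

end SmoothingSemigroup
end Smoothing

/-! ### Volterra equations with a weakly singular kernel -/

section Volterra

variable {X Z : Type*} [NormedAddCommGroup X] [NormedAddCommGroup Z]

/-- An operator-valued Volterra kernel on `(0, θ]` with an integrable singularity at `0`. -/
structure WeaklySingular (k : ℝ → Z → X) (C γ θ : ℝ) : Prop where
  continuousOn : ContinuousOn (fun q : ℝ × Z => k q.1 q.2) (Ioc 0 θ ×ˢ univ)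
  map_sub : ∀ σ ∈ Ioc 0 θ, ∀ y y', k σ (y - y') = k σ y - k σ y'
  norm_le : ∀ σ ∈ Ioc 0 θ, ∀ y, ‖k σ y‖ ≤ C * σ ^ (γ - 1) * ‖y‖
  C_nonneg : 0 ≤ C
  γ_pos : 0 < γ

/-- The operator norm of the Volterra operator with kernel bound `C σ ^ (γ - 1)`, for the norm
with weight `exp (-μ t)`. -/
def volterraNorm (C γ μ : ℝ) : ℝ := C * ((1 / μ) ^ γ * Real.Gamma γ)

/-- A steep exponential weight makes the integral operator as small as desired, since μ^{-γ} → 0; no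
subdivision of the time interval is needed. -/
lemma exists_volterraNorm_le {C γ : ℝ} (hγ : 0 < γ) {ε : ℝ} (hε : 0 < ε) :
    ∃ μ : ℝ, 0 < μ ∧ volterraNorm C γ μ ≤ ε := by
  have h1 : Tendsto (fun μ : ℝ => (1 / μ) ^ γ) atTop (𝓝 0) := by
    have h := tendsto_rpow_neg_atTop hγ
    refine h.congr' ?_
    filter_upwards [eventually_gt_atTop 0] with μ hμ
    rw [one_div, Real.inv_rpow hμ.le, Real.rpow_neg hμ.le]
  have h2 : Tendsto (volterraNorm C γ) atTop (𝓝 0) := by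
    have := (h1.mul_const (Real.Gamma γ)).const_mul C
    rw [zero_mul, mul_zero] at this
    exact this
  exact ((eventually_gt_atTop 0).and (h2.eventually_le_const hε)).exists

lemma integrableOn_rpow_sub_one_mul_exp {γ μ : ℝ} (hγ : 0 < γ) (hμ : 0 < μ) :
    IntegrableOn (fun σ : ℝ => σ ^ (γ - 1) * Real.exp (-(μ * σ))) (Ioi 0) := by
  simpa using integrableOn_rpow_mul_exp_neg_mul_rpow (p := 1) (s := γ - 1) (b := μ)
    (by linarith) one_pos hμ

/-- After σ = t - s the integral is a piece of the Gamma integral of σ^{γ-1} e^{-μσ} over (0,∞). -/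
lemma integral_weight_le {γ μ : ℝ} (hγ : 0 < γ) (hμ : 0 < μ) {a t : ℝ} (hat : a ≤ t) :
    ∫ s in a..t, (t - s) ^ (γ - 1) * Real.exp (μ * (s - a)) ≤
      (1 / μ) ^ γ * Real.Gamma γ * Real.exp (μ * (t - a)) := by
  have h1 : ∀ s : ℝ, (t - s) ^ (γ - 1) * Real.exp (μ * (s - a)) =
      Real.exp (μ * (t - a)) * ((t - s) ^ (γ - 1) * Real.exp (-(μ * (t - s)))) := by
    intro s
    rw [mul_left_comm, ← Real.exp_add]
    ring_nf
  simp_rw [h1]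
  rw [intervalIntegral.integral_const_mul, intervalIntegral.integral_comp_sub_left
    (fun σ => σ ^ (γ - 1) * Real.exp (-(μ * σ))), sub_self,
    intervalIntegral.integral_of_le (by linarith), mul_comm]
  gcongr
  rw [← Real.integral_rpow_mul_exp_neg_mul_Ioi hγ hμ]
  apply setIntegral_mono_set (integrableOn_rpow_sub_one_mul_exp hγ hμ)
  · filter_upwards [ae_restrict_mem measurableSet_Ioi] with σ hσ
    have : 0 < σ := hσ
    simp only [Pi.zero_apply]
    positivity
  · exact Ioc_subset_Ioi_self.eventuallyLE

lemma intervalIntegrable_weight {γ μ : ℝ} (hγ : 0 < γ) (a t : ℝ) :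
    IntervalIntegrable (fun s => (t - s) ^ (γ - 1) * Real.exp (μ * (s - a))) volume a t := by
  apply IntervalIntegrable.mul_continuousOn
  · have := (intervalIntegral.intervalIntegrable_rpow' (a := t - a) (b := 0)
      (show -1 < γ - 1 by linarith)).comp_sub_left t
    simpa using this
  · fun_prop

variable {k : ℝ → Z → X} {C γ θ : ℝ}

/-- The kernel is controlled only for σ > 0; the end point s = t is a null set and is removed first.
-/
lemma WeaklySingular.aestronglyMeasurable (hk : WeaklySingular k C γ θ) {a t : ℝ}
    (hθ : t - a ≤ θ) {h : ℝ → Z} (hh : ContinuousOn h (Icc a t)) :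
    AEStronglyMeasurable (fun s => k (t - s) (h s)) (volume.restrict (Ioc a t)) := by
  rw [← restrict_Ioo_eq_restrict_Ioc]
  apply ContinuousOn.aestronglyMeasurable _ measurableSet_Ioo
  have h2 : ContinuousOn (fun s => (t - s, h s)) (Ioo a t) :=
    ContinuousOn.prodMk (by fun_prop) (hh.mono Ioo_subset_Icc_self)
  exact hk.continuousOn.comp h2 fun s hs =>
    ⟨⟨by linarith [hs.2], by linarith [hs.1]⟩, mem_univ _⟩

lemma WeaklySingular.norm_le_weight (hk : WeaklySingular k C γ θ) {a t : ℝ}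
    (hθ : t - a ≤ θ) {h : ℝ → Z} {N μ : ℝ}
    (hN : ∀ s ∈ Ioo a t, ‖h s‖ ≤ N * Real.exp (μ * (s - a))) :
    ∀ᵐ s ∂volume.restrict (Ioc a t),
      ‖k (t - s) (h s)‖ ≤ C * N * ((t - s) ^ (γ - 1) * Real.exp (μ * (s - a))) := by
  rw [← restrict_Ioo_eq_restrict_Ioc]
  filter_upwards [ae_restrict_mem measurableSet_Ioo] with s hs
  have hts : 0 < t - s := by linarith [hs.2]
  have hC := hk.C_nonneg
  refine (hk.norm_le (t - s) ⟨hts, by linarith [hs.1]⟩ (h s)).trans ?_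
  calc _ ≤ C * (t - s) ^ (γ - 1) * (N * Real.exp (μ * (s - a))) := by
        gcongr; exact hN s hs
    _ = _ := by ring

lemma WeaklySingular.intervalIntegrable (hk : WeaklySingular k C γ θ) {a t : ℝ} (hat : a ≤ t)
    (hθ : t - a ≤ θ) {h : ℝ → Z} (hh : ContinuousOn h (Icc a t)) :
    IntervalIntegrable (fun s => k (t - s) (h s)) volume a t := by
  obtain ⟨N, hN⟩ := isCompact_Icc.exists_bound_of_continuousOn hh
  rw [intervalIntegrable_iff_integrableOn_Ioc_of_le hat]
  have h1 := (intervalIntegrable_iff_integrableOn_Ioc_of_le hat).1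
    (intervalIntegrable_weight (μ := 0) hk.γ_pos a t)
  refine (h1.const_mul (C * N)).mono' (hk.aestronglyMeasurable hθ hh) ?_
  exact hk.norm_le_weight hθ fun s hs => by simpa using hN s (Ioo_subset_Icc_self hs)

variable [NormedSpace ℝ X]

lemma WeaklySingular.norm_integral_le (hk : WeaklySingular k C γ θ) {a t : ℝ} (hat : a ≤ t)
    (hθ : t - a ≤ θ) {h : ℝ → Z} {N μ : ℝ} (hμ : 0 < μ) (hN0 : 0 ≤ N)
    (hN : ∀ s ∈ Ioo a t, ‖h s‖ ≤ N * Real.exp (μ * (s - a))) :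
    ‖∫ s in a..t, k (t - s) (h s)‖ ≤ volterraNorm C γ μ * N * Real.exp (μ * (t - a)) := by
  have h1 := (intervalIntegrable_iff_integrableOn_Ioc_of_le hat).1
    (intervalIntegrable_weight (μ := μ) hk.γ_pos a t)
  rw [intervalIntegral.integral_of_le hat]
  refine (norm_integral_le_of_norm_le (h1.const_mul (C * N)) (hk.norm_le_weight hθ hN)).trans ?_
  rw [integral_const_mul, ← intervalIntegral.integral_of_le hat]
  have h2 := integral_weight_le hk.γ_pos hμ hat
  have hC := hk.C_nonneg
  calc _ ≤ C * N * ((1 / μ) ^ γ * Real.Gamma γ * Real.exp (μ * (t - a))) := by gcongr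
    _ = _ := by rw [volterraNorm]; ring

lemma WeaklySingular.integral_sub (hk : WeaklySingular k C γ θ) {a t : ℝ} (hat : a ≤ t)
    (hθ : t - a ≤ θ) {h h' : ℝ → Z} (hh : ContinuousOn h (Icc a t))
    (hh' : ContinuousOn h' (Icc a t)) :
    (∫ s in a..t, k (t - s) (h s)) - ∫ s in a..t, k (t - s) (h' s) =
      ∫ s in a..t, k (t - s) (h s - h' s) := by
  rw [← intervalIntegral.integral_sub (hk.intervalIntegrable hat hθ hh)
    (hk.intervalIntegrable hat hθ hh'), intervalIntegral.integral_of_le hat,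
    intervalIntegral.integral_of_le hat, ← restrict_Ioo_eq_restrict_Ioc]
  apply setIntegral_congr_fun measurableSet_Ioo
  intro s hs
  exact (hk.map_sub (t - s) ⟨by linarith [hs.2], by linarith [hs.1]⟩ _ _).symm

/-- With σ = t - s the singularity stays at the fixed point 0, and t enters only through h(t - σ)
and an indicator. Dominated convergence with C N σ^{γ-1} applies: for σ ≠ t₀ - a the integrand is
continuous at t₀. -/
lemma WeaklySingular.continuousOn_integral (hk : WeaklySingular k C γ θ) {a T : ℝ}
    (hθ : T - a ≤ θ) {h : ℝ → Z} (hh : Continuous h) :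
    ContinuousOn (fun t => ∫ s in a..t, k (t - s) (h s)) (Icc a T) := by
  obtain ⟨N, hN⟩ := isCompact_Icc.exists_bound_of_continuousOn (s := Icc a T) hh.continuousOn
  set f : ℝ → ℝ → X := fun t σ => (Ioo 0 (t - a)).indicator (fun σ => k σ (h (t - σ))) σ with hf
  have e : ∀ t ∈ Icc a T, ∫ s in a..t, k (t - s) (h s) = ∫ σ in Ioc 0 θ, f t σ := by
    intro t ht
    have h1 := intervalIntegral.integral_comp_sub_left (a := a) (b := t)
      (fun σ => k σ (h (t - σ))) t
    simp only [sub_sub_cancel, sub_self] at h1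
    rw [h1, intervalIntegral.integral_of_le (by linarith [ht.1]), ← restrict_Ioo_eq_restrict_Ioc,
      setIntegral_indicator measurableSet_Ioo, inter_eq_right.2]
    exact fun σ hσ => ⟨hσ.1, by linarith [hσ.2, ht.2]⟩
  have hC := hk.C_nonneg
  refine ContinuousOn.congr ?_ e
  intro t₀ ht₀
  refine continuousWithinAt_of_dominated (bound := fun σ => C * N * σ ^ (γ - 1)) ?_ ?_ ?_ ?_
  · filter_upwards [self_mem_nhdsWithin] with t ht
    rw [aestronglyMeasurable_indicator_iff measurableSet_Ioo,
      Measure.restrict_restrict measurableSet_Ioo]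
    refine ContinuousOn.aestronglyMeasurable ?_ (measurableSet_Ioo.inter measurableSet_Ioc)
    have h2 : ContinuousOn (fun σ => (σ, h (t - σ))) (Ioo 0 (t - a) ∩ Ioc 0 θ) := by fun_prop
    exact hk.continuousOn.comp h2 fun σ hσ => ⟨hσ.2, mem_univ _⟩
  · filter_upwards [self_mem_nhdsWithin] with t ht
    filter_upwards [ae_restrict_mem measurableSet_Ioc] with σ hσ
    have hN0 : 0 ≤ N := (norm_nonneg _).trans (hN t ht)
    have hσ0 := hσ.1
    by_cases hm : σ ∈ Ioo 0 (t - a)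
    · simp only [hf, indicator_of_mem hm]
      refine (hk.norm_le σ hσ _).trans ?_
      have := hN (t - σ) ⟨by linarith [hm.2], by linarith [ht.2, hm.1]⟩
      calc _ ≤ C * σ ^ (γ - 1) * N := by gcongr
        _ = _ := by ring
    · simp only [hf, indicator_of_notMem hm, norm_zero]
      positivity
  · refine Integrable.const_mul ?_ _
    by_cases h0 : 0 ≤ θ
    · exact (intervalIntegrable_iff_integrableOn_Ioc_of_le h0).1
        (intervalIntegral.intervalIntegrable_rpow' (by linarith [hk.γ_pos]))
    · rw [Ioc_eq_empty (by linarith)]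
      simp
  · filter_upwards [ae_restrict_mem measurableSet_Ioc,
      ae_restrict_of_ae (Measure.ae_ne volume (t₀ - a))] with σ hσ hne
    apply ContinuousAt.continuousWithinAt
    rcases lt_or_gt_of_ne hne with hlt | hgt
    · have h3 : ContinuousAt (fun t => k σ (h (t - σ))) t₀ := by
        have h4 : Continuous fun z => k σ z := by
          rw [← continuousOn_univ]
          exact hk.continuousOn.comp (f := fun z => (σ, z)) (by fun_prop)
            fun z _ => ⟨hσ, mem_univ z⟩
        exact (h4.comp (hh.comp (continuous_sub_right σ))).continuousAt
      refine h3.congr ?_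
      filter_upwards [Ioi_mem_nhds (show a + σ < t₀ by linarith)] with t ht
      have ht' : a + σ < t := ht
      have hm : σ ∈ Ioo 0 (t - a) := ⟨hσ.1, by linarith⟩
      simp only [hf, indicator_of_mem hm]
    · refine (continuousAt_const (y := (0 : X))).congr ?_
      filter_upwards [Iio_mem_nhds (show t₀ < a + σ by linarith)] with t ht
      have ht' : t < a + σ := ht
      have hm : σ ∉ Ioo 0 (t - a) := fun hm => by linarith [hm.2]
      simp only [hf, indicator_of_notMem hm]

/-- Stability of Volterra equations with a weakly singular kernel. -/
lemma WeaklySingular.norm_sub_le (hk : WeaklySingular k C γ θ) {a T : ℝ} (hθ : T - a ≤ θ)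
    {b b' g g' : ℝ → X} {f f' : ℝ → Z} (hb : ContinuousOn b (Icc a T))
    (hb' : ContinuousOn b' (Icc a T)) (hf : ContinuousOn f (Icc a T))
    (hf' : ContinuousOn f' (Icc a T))
    (h : ∀ t ∈ Icc a T, b t = g t + ∫ s in a..t, k (t - s) (f s))
    (h' : ∀ t ∈ Icc a T, b' t = g' t + ∫ s in a..t, k (t - s) (f' s))
    {G P lam μ : ℝ} (hP : 0 ≤ P) (hlam : 0 ≤ lam) (hμ : 0 < μ)
    (hq : volterraNorm C γ μ ≤ 1 / (2 * (lam + 1)))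
    (hg : ∀ t ∈ Icc a T, ‖g t - g' t‖ ≤ G)
    (hff : ∀ s ∈ Icc a T, ‖f s - f' s‖ ≤ P + lam * ‖b s - b' s‖) {t : ℝ} (ht : t ∈ Icc a T) :
    ‖b t - b' t‖ ≤ 2 * (G + P) * Real.exp (μ * (t - a)) := by
  set q := volterraNorm C γ μ with hqdef
  have hq0 : 0 ≤ q := by
    have := hk.C_nonneg
    have := hk.γ_pos
    rw [hqdef, volterraNorm]
    positivity
  -- This yields both q ≤ 1/2 and q · lam ≤ 1/2, and the summand 1 covers lam = 0.
  have hq1 : q * (lam + 1) ≤ 1 / 2 := by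
    rw [le_div_iff₀ (by positivity)] at hq
    linarith
  -- The weighted difference is estimated at its maximum t₁; there the equation bounds w(t₁) by G +
  -- q(P + lam w(t₁)), and the last term is absorbed on the left. This replaces a singular Gronwall
  -- inequality.
  set w : ℝ → ℝ := fun t => Real.exp (-(μ * (t - a))) * ‖b t - b' t‖ with hw
  have hwc : ContinuousOn w (Icc a T) :=
    (by fun_prop : Continuous fun t : ℝ => Real.exp (-(μ * (t - a)))).continuousOn.mul
      (hb.sub hb').norm
  obtain ⟨t₁, ht₁, hmax⟩ := isCompact_Icc.exists_isMaxOn ⟨t, ht⟩ hwc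
  have hG : 0 ≤ G := (norm_nonneg _).trans (hg t ht)
  have hle : ∀ s ∈ Icc a T, ‖b s - b' s‖ ≤ w t₁ * Real.exp (μ * (s - a)) := by
    intro s hs
    have h1 : w s ≤ w t₁ := hmax hs
    have h2 : ‖b s - b' s‖ = w s * Real.exp (μ * (s - a)) := by
      rw [hw]
      simp only
      rw [mul_right_comm, ← Real.exp_add]
      simp
    rw [h2]
    gcongr
  have hw0 : 0 ≤ w t₁ := by rw [hw]; positivity
  have hexp : ∀ s ∈ Icc a T, 1 ≤ Real.exp (μ * (s - a)) := fun s hs =>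
    Real.one_le_exp (mul_nonneg hμ.le (by linarith [hs.1]))
  have hmain : ‖b t₁ - b' t₁‖ ≤ G + q * (P + lam * w t₁) * Real.exp (μ * (t₁ - a)) := by
    have e : b t₁ - b' t₁ = (g t₁ - g' t₁) + ∫ s in a..t₁, k (t₁ - s) (f s - f' s) := by
      have hsub : Icc a t₁ ⊆ Icc a T := Icc_subset_Icc_right ht₁.2
      rw [h t₁ ht₁, h' t₁ ht₁, ← hk.integral_sub ht₁.1 (by linarith [ht₁.2]) (hf.mono hsub)
        (hf'.mono hsub)]
      abel
    rw [e]
    refine (norm_add_le _ _).trans (add_le_add (hg t₁ ht₁) ?_)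
    refine hk.norm_integral_le ht₁.1 (by linarith [ht₁.2]) hμ (by positivity) fun s hs => ?_
    have hs' : s ∈ Icc a T := ⟨hs.1.le, hs.2.le.trans ht₁.2⟩
    calc _ ≤ P + lam * ‖b s - b' s‖ := hff s hs'
      _ ≤ P * Real.exp (μ * (s - a)) + lam * (w t₁ * Real.exp (μ * (s - a))) :=
        add_le_add (le_mul_of_one_le_right hP (hexp s hs'))
          (mul_le_mul_of_nonneg_left (hle s hs') hlam)
      _ = _ := by ring
  have hw1 : w t₁ ≤ G + q * (P + lam * w t₁) := by
    have h1 : Real.exp (-(μ * (t₁ - a))) ≤ 1 := by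
      rw [Real.exp_neg]; exact inv_le_one_of_one_le₀ (hexp t₁ ht₁)
    calc w t₁ ≤ Real.exp (-(μ * (t₁ - a))) *
          (G + q * (P + lam * w t₁) * Real.exp (μ * (t₁ - a))) :=
          mul_le_mul_of_nonneg_left hmain (Real.exp_pos _).le
      _ = Real.exp (-(μ * (t₁ - a))) * G + q * (P + lam * w t₁) *
          (Real.exp (-(μ * (t₁ - a))) * Real.exp (μ * (t₁ - a))) := by ring
      _ = Real.exp (-(μ * (t₁ - a))) * G + q * (P + lam * w t₁) := by
          rw [← Real.exp_add]; simp
      _ ≤ _ := by nlinarith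
  have hfin : w t₁ ≤ 2 * (G + P) := by nlinarith [mul_nonneg hq0 hlam]
  exact (hle t ht).trans (by gcongr)

/-- Global existence for Volterra equations with a weakly singular kernel and a nonlinearity of
linear growth which is Lipschitz on bounded sets. -/
lemma WeaklySingular.exists_solution [CompleteSpace X] (hk : WeaklySingular k C γ θ) {a T : ℝ}
    (haT : a ≤ T) (hθ : T - a ≤ θ) {g : ℝ → X} (hg : ContinuousOn g (Icc a T))
    {F : ℝ → X → Z} (hF : Continuous fun q : ℝ × X => F q.1 q.2) {lam lam₁ lam₂ : ℝ}
    (hlam : 0 ≤ lam) (hlam₁ : 0 ≤ lam₁) (hlam₂ : 0 ≤ lam₂)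
    (hgrow : ∀ s x, ‖F s x‖ ≤ lam * ‖x‖)
    (hlip : ∀ s x x', ‖F s x - F s x'‖ ≤ lam₁ * (1 + lam₂ * ‖x‖) * ‖x - x'‖) :
    ∃ b : ℝ → X, Continuous b ∧
      ∀ t ∈ Icc a T, b t = g t + ∫ s in a..t, k (t - s) (F s (b s)) := by
  obtain ⟨G, hG⟩ := isCompact_Icc.exists_bound_of_continuousOn hg
  have hG0 : 0 ≤ G := (norm_nonneg _).trans (hG a ⟨le_rfl, haT⟩)
  obtain ⟨μ, hμ, hq⟩ := exists_volterraNorm_le (C := C) hk.γ_pos (ε := 1 / (2 * (lam + 1)))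
    (by positivity)
  -- The ball is invariant because the free term contributes at most G and the integral at most q ·
  -- lam · ρ ≤ ρ/2 = G.
  set ρ := 2 * G with hρ
  have hρ0 : 0 ≤ ρ := by positivity
  -- Lipschitz constant on that ball; only after it is known can the second, steeper weight ν be
  -- chosen to make the map a contraction.
  set lam₃ := lam₁ * (1 + lam₂ * (ρ * Real.exp (μ * (T - a)))) with hlam₃
  have hlam₃0 : 0 ≤ lam₃ := by positivity
  obtain ⟨ν, hν, hq'⟩ := exists_volterraNorm_le (C := C) hk.γ_pos (ε := 1 / (2 * (lam₃ + 1)))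
    (by positivity)
  have hqle : ∀ {l μ : ℝ}, 0 ≤ l → 0 < μ → volterraNorm C γ μ ≤ 1 / (2 * (l + 1)) →
      volterraNorm C γ μ * l ≤ 1 / 2 := by
    intro l μ hl hμ h
    have h0 : 0 ≤ volterraNorm C γ μ := by
      have := hk.C_nonneg
      have := hk.γ_pos
      rw [volterraNorm]
      positivity
    rw [le_div_iff₀ (by positivity)] at h
    nlinarith
  -- the unknown is `c t = exp (-ν (t - a)) b t`
  let B : C(Icc a T, X) → ℝ → X := fun c s => Real.exp (ν * (s - a)) • IccExtend haT c s
  have hBc : ∀ c, Continuous (B c) := fun c =>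
    (by fun_prop : Continuous fun s : ℝ => Real.exp (ν * (s - a))).smul
      (c.continuous.Icc_extend')
  have hBdist : ∀ c c' s, ‖B c s - B c' s‖ ≤ dist c c' * Real.exp (ν * (s - a)) := by
    intro c c' s
    simp only [B]
    rw [← smul_sub, norm_smul, Real.norm_eq_abs, Real.abs_exp, mul_comm, ← dist_eq_norm]
    gcongr
    exact ContinuousMap.dist_apply_le_dist _
  have hFc : ∀ c, Continuous fun s => F s (B c s) := fun c =>
    hF.comp (continuous_id.prodMk (hBc c))
  let Ψ : C(Icc a T, X) → C(Icc a T, X) := fun c =>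
    ⟨fun t => Real.exp (-(ν * (t - a))) • (g t + ∫ s in a..t, k (t - s) (F s (B c s))), by
      have h1 := (hg.add (hk.continuousOn_integral hθ (hFc c))).domRestrict
      have h2 : Continuous fun t : Icc a T => Real.exp (-(ν * ((t : ℝ) - a))) := by fun_prop
      exact h2.smul h1⟩
  have hΨ : ∀ c (t : Icc a T), Ψ c t =
      Real.exp (-(ν * (t - a))) • (g t + ∫ s in a..t, k (t - s) (F s (B c s))) := fun _ _ => rfl
  -- Two weights are in play: invariance of K uses μ and linear growth, while distances are measured
  -- with weight ν.
  let K : Set C(Icc a T, X) :=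
    {c | ∀ s ∈ Icc a T, ‖B c s‖ ≤ ρ * Real.exp (μ * (s - a))}
  have hKc : IsClosed K := by
    have : K = ⋂ s ∈ Icc a T, {c | ‖B c s‖ ≤ ρ * Real.exp (μ * (s - a))} := by
      ext c; simp [K]
    rw [this]
    refine isClosed_biInter fun s hs => isClosed_le ?_ continuous_const
    simp only [B, IccExtend, Function.comp_def]
    exact ((continuous_eval_const _).const_smul _).norm
  have hBΨ : ∀ c, ∀ t ∈ Icc a T, B (Ψ c) t = g t + ∫ s in a..t, k (t - s) (F s (B c s)) := by
    intro c t ht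
    have e : B (Ψ c) t = Real.exp (ν * (t - a)) • IccExtend haT (Ψ c) t := rfl
    rw [e, IccExtend_of_mem haT _ ht, hΨ, smul_smul, ← Real.exp_add, add_neg_cancel, Real.exp_zero,
      one_smul]
  have hmaps : MapsTo Ψ K K := by
    intro c hc t ht
    rw [hBΨ c t ht]
    have h1 := hk.norm_integral_le (h := fun s => F s (B c s)) (N := lam * ρ) ht.1
      (by linarith [ht.2]) hμ (by positivity) fun s hs => by
        refine (hgrow s _).trans ?_
        rw [mul_assoc]
        gcongr
        exact hc s ⟨hs.1.le, hs.2.le.trans ht.2⟩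
    have h2 : 1 ≤ Real.exp (μ * (t - a)) :=
      Real.one_le_exp (mul_nonneg hμ.le (by linarith [ht.1]))
    have h3 : volterraNorm C γ μ * (lam * ρ) ≤ G := by
      have := mul_le_mul_of_nonneg_right (hqle hlam hμ hq) hρ0
      linarith
    refine (norm_add_le _ _).trans ?_
    calc _ ≤ G * Real.exp (μ * (t - a)) + G * Real.exp (μ * (t - a)) :=
          add_le_add ((hG t ht).trans (le_mul_of_one_le_right hG0 h2)) (h1.trans (by gcongr))
      _ = _ := by rw [hρ]; ring
  have hcontr : ∀ c ∈ K, ∀ c' ∈ K, dist (Ψ c) (Ψ c') ≤ 1 / 2 * dist c c' := by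
    intro c hc c' hc'
    rw [ContinuousMap.dist_le (by positivity)]
    intro t
    have hsub : ∀ s ∈ Ioo a (t : ℝ), s ∈ Icc a T := fun s hs => ⟨hs.1.le, hs.2.le.trans t.2.2⟩
    have h1 := hk.norm_integral_le (h := fun s => F s (B c s) - F s (B c' s))
      (N := lam₃ * dist c c') t.2.1 (by linarith [t.2.2]) hν (by positivity) fun s hs => by
        refine (hlip s _ _).trans ?_
        rw [mul_assoc lam₃]
        have h2 := hc s (hsub s hs)
        have h3 : ρ * Real.exp (μ * (s - a)) ≤ ρ * Real.exp (μ * (T - a)) := by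
          gcongr
          exact (hsub s hs).2
        have h4 := hBdist c c' s
        rw [hlam₃]
        gcongr
        exact h2.trans h3
    rw [← hk.integral_sub t.2.1 (by linarith [t.2.2]) (hFc c).continuousOn
      (hFc c').continuousOn] at h1
    rw [dist_eq_norm, hΨ, hΨ, ← smul_sub, add_sub_add_left_eq_sub, norm_smul, Real.norm_eq_abs,
      Real.abs_exp]
    calc _ ≤ Real.exp (-(ν * (t - a))) *
          (volterraNorm C γ ν * (lam₃ * dist c c') * Real.exp (ν * (t - a))) := by gcongr
      _ = volterraNorm C γ ν * lam₃ * dist c c' *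
          (Real.exp (-(ν * (t - a))) * Real.exp (ν * (t - a))) := by ring
      _ = volterraNorm C γ ν * lam₃ * dist c c' := by rw [← Real.exp_add]; simp
      _ ≤ _ := by gcongr; exact hqle hlam₃0 hν hq'
  have hzero : (0 : C(Icc a T, X)) ∈ K := fun s hs => by
    simp only [B, IccExtend, Function.comp_def, ContinuousMap.zero_apply, smul_zero, norm_zero]
    positivity
  have hC : ContractingWith (1 / 2) (hmaps.restrict Ψ K K) := by
    refine ⟨by rw [← NNReal.coe_lt_coe]; norm_num, LipschitzWith.of_dist_le_mul fun c c' => ?_⟩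
    rw [show ((1 / 2 : NNReal) : ℝ) = 1 / 2 by norm_num]
    exact hcontr c c.2 c' c'.2
  obtain ⟨c, -, hc, -⟩ := hC.exists_fixedPoint' hKc.isComplete hmaps hzero (edist_ne_top _ _)
  refine ⟨B c, hBc c, fun t ht => ?_⟩
  rw [← hBΨ c t ht, hc.eq]

end Volterra

/-! ### The kernel of the mild equation -/

section Kernel

variable {B₁ B : Type*} [NormedAddCommGroup B₁] [NormedSpace ℝ B₁] [NormedAddCommGroup B]
  [NormedSpace ℝ B]

/-- The kernel `β σ^{β-1} E_β'(A σ^β)` of the mild equation, with values in `B₁`. -/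
def mildKernel (i : B₁ →L[ℝ] B) (S : ℝ → B →L[ℝ] B) (β σ : ℝ) (y : B) : B₁ :=
  (β * σ ^ (β - 1)) • smoothDerivOp i S β (σ ^ β) y

/-- The singularity is σ^{β-1} (σ^β)^{-ω} = σ^{β(1-ω)-1}; the prefactor β cancels the 1/β of
`smoothDerivOp`. Joint continuity follows from strong continuity and this bound. -/
lemma SmoothingSemigroup.weaklySingular_mildKernel {i : B₁ →L[ℝ] B} {S : ℝ → B →L[ℝ] B}
    {S₁ : ℝ → B₁ →L[ℝ] B₁} {M m M₁ m₁ κ ω : ℝ} (hS : SmoothingSemigroup i S S₁ M m M₁ m₁ κ ω)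
    {β C θ : ℝ} (hβ : β ∈ Ioo (0 : ℝ) 1) (hC0 : 0 ≤ C)
    (hC : ∀ x : ℝ, 0 < x →
      |zolotarevWeight β x| ≤ C * Real.exp (-(((m₁ + 1) * θ ^ β + 1) * x))) :
    WeaklySingular (mildKernel i S β) (C * (κ * (1 + M₁)) * Real.Gamma (2 - ω)) (β * (1 - ω))
      θ := by
  have hκ := hS.κ_pos
  have hM₁ := hS.M₁_nonneg
  have hβ0 := hβ.1
  have hG : 0 < Real.Gamma (2 - ω) := Real.Gamma_pos_of_pos (by linarith [hS.ω_mem.2])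
  have hpow : ∀ σ ∈ Ioc 0 θ, σ ^ β ∈ Ioc 0 (θ ^ β) := fun σ hσ =>
    ⟨Real.rpow_pos_of_pos hσ.1 β, Real.rpow_le_rpow hσ.1.le hσ.2 hβ0.le⟩
  have hsub : ∀ σ ∈ Ioc 0 θ, ∀ y y', mildKernel i S β σ (y - y') =
      mildKernel i S β σ y - mildKernel i S β σ y' := by
    intro σ hσ y y'
    rw [mildKernel, hS.smoothDerivOp_sub hβ (hpow σ hσ).1, smul_sub, mildKernel, mildKernel]
  have hle : ∀ σ ∈ Ioc 0 θ, ∀ y, ‖mildKernel i S β σ y‖ ≤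
      C * (κ * (1 + M₁)) * Real.Gamma (2 - ω) * σ ^ (β * (1 - ω) - 1) * ‖y‖ := by
    intro σ hσ y
    have hσ0 := hσ.1
    have h1 := hS.norm_smoothDerivOp_le hβ0 hC (hpow σ hσ) y
    rw [mildKernel, norm_smul, Real.norm_eq_abs, abs_of_pos (by positivity)]
    refine (mul_le_mul_of_nonneg_left h1 (by positivity)).trans (le_of_eq ?_)
    have e1 : σ ^ (β * (1 - ω) - 1) = σ ^ (β - 1) * (σ ^ β) ^ (-ω) := by
      rw [← Real.rpow_mul hσ0.le, ← Real.rpow_add hσ0]; ring_nf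
    rw [e1]
    field_simp
  refine ⟨continuousOn_uncurry_of_bound hsub ?_ hle ?_, hsub, hle, by positivity, ?_⟩
  · refine ContinuousOn.const_mul ?_ _
    exact fun σ hσ => (Real.continuousAt_rpow_const σ _ (Or.inl hσ.1.ne')).continuousWithinAt
  · intro y
    refine ContinuousOn.smul ?_ ?_
    · refine ContinuousOn.const_mul ?_ _
      exact fun σ hσ => (Real.continuousAt_rpow_const σ _ (Or.inl hσ.1.ne')).continuousWithinAt
    · refine (hS.continuousOn_smoothDerivOp hβ y).comp ?_ fun σ hσ => (hpow σ hσ).1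
      exact fun σ hσ => (Real.continuousAt_rpow_const σ _ (Or.inl hσ.1.ne')).continuousWithinAt
  · exact mul_pos hβ0 (by linarith [hS.ω_mem.2])

end Kernel

/-! ### Existence and uniqueness for the mild equation -/

section Equation

variable {B₂ : Type u₂} {B₁ : Type u₁} {B : Type u₀} {P : Type u₃}
  [NormedAddCommGroup B₂] [NormedSpace ℝ B₂]
  [NormedAddCommGroup B₁] [NormedSpace ℝ B₁]
  [NormedAddCommGroup B] [NormedSpace ℝ B]

lemma GeneratesSemigroup.exists_smoothingSemigroup {𝒯 : BanachTriple B₂ B₁ B} {A : B₂ →L[ℝ] B}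
    {S : ℝ → B →L[ℝ] B} {M m M₁ m₁ κ ω : ℝ} (hA : GeneratesSemigroup 𝒯 A S M m M₁ m₁)
    (hs : Smoothing 𝒯 S κ ω) (hω : ω ∈ Ioo (0 : ℝ) 1) (hκ : 0 < κ)
    (hM : 0 ≤ M) (hm : 0 ≤ m) (hM₁ : 0 ≤ M₁) (hm₁ : 0 ≤ m₁) :
    ∃ S₁ : ℝ → B₁ →L[ℝ] B₁, SmoothingSemigroup 𝒯.i₁ S S₁ M m M₁ m₁ κ ω := by
  obtain ⟨S₁, h1, h2, h3⟩ := hA.restrict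
  exact ⟨S₁, 𝒯.injective_i₁, hA.semigroup, h1, h2, hM, hm, hA.norm_le, hM₁, hm₁, h3, hs.maps,
    hs.bound, hκ, hω⟩

section Nonlinearity

variable {n : ℕ} {H : ℝ → B → (Fin n → B) → P → B} {L L' Lpar : ℝ}
  {𝒯 : BanachTriple B₂ B₁ B} {D : Fin n → B₁ →L[ℝ] B}

lemma DerivationBounds.sum_norm_le (hD : DerivationBounds 𝒯 D) (x : B₁) :
    ∑ j, ‖D j x‖ ≤ n * ‖x‖ := by
  have h : ∀ j ∈ Finset.univ, ‖D j x‖ ≤ ‖x‖ := fun j _ => by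
    simpa using (D j).le_of_opNorm_le (hD.norm_le j) x
  simpa using Finset.sum_le_sum h

variable [NormedAddCommGroup P]

lemma HamiltonianBounds.norm_comp_le (hH : HamiltonianBounds H L L' Lpar)
    (hD : DerivationBounds 𝒯 D) (hL : 0 ≤ L) (α : P) (s : ℝ) (x : B₁) :
    ‖H s (𝒯.i₁ x) (fun j => D j x) α‖ ≤ L * n * ‖x‖ := by
  refine (hH.growth _ _ _ _).trans ?_
  rw [mul_assoc]
  gcongr
  exact hD.sum_norm_le x

/-- The asymmetry matters: ‖x'‖ does not occur, so in comparisons a bound for one of the two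
solutions suffices. -/
lemma HamiltonianBounds.norm_comp_sub_le (hH : HamiltonianBounds H L L' Lpar)
    (hD : DerivationBounds 𝒯 D) (hL : 0 ≤ L) (hL' : 0 ≤ L') (α : P) (s : ℝ) (x x' : B₁) :
    ‖H s (𝒯.i₁ x) (fun j => D j x) α - H s (𝒯.i₁ x') (fun j => D j x') α‖ ≤
      L * (1 + n) * (1 + L' * n * ‖x‖) * ‖x - x'‖ := by
  refine (hH.lipschitz _ _ _ _ _ _).trans ?_
  have h1 : ‖𝒯.i₁ x - 𝒯.i₁ x'‖ ≤ ‖x - x'‖ := by rw [← map_sub]; exact 𝒯.norm_i₁_le _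
  have h2 : ∑ j, ‖D j x - D j x'‖ ≤ n * ‖x - x'‖ := by
    simp_rw [← map_sub]; exact hD.sum_norm_le _
  have h3 := hD.sum_norm_le x
  have h0 : 0 ≤ ∑ j, ‖D j x‖ := Finset.sum_nonneg fun _ _ => norm_nonneg _
  calc _ ≤ L * (‖x - x'‖ + n * ‖x - x'‖) * (1 + L' * (n * ‖x‖)) := by gcongr
    _ = _ := by ring

lemma HamiltonianBounds.norm_comp_par_sub_le (hH : HamiltonianBounds H L L' Lpar)
    (hD : DerivationBounds 𝒯 D) (hLpar : 0 ≤ Lpar) (α α' : P) (s : ℝ) (x : B₁) :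
    ‖H s (𝒯.i₁ x) (fun j => D j x) α - H s (𝒯.i₁ x) (fun j => D j x) α'‖ ≤
      Lpar * ‖α - α'‖ * (1 + n * ‖x‖) := by
  refine (hH.lipschitz_par _ _ _ _ _).trans ?_
  gcongr
  exact hD.sum_norm_le x

lemma HamiltonianBounds.continuous_comp (hH : HamiltonianBounds H L L' Lpar)
    (𝒯 : BanachTriple B₂ B₁ B)
    (D : Fin n → B₁ →L[ℝ] B) (α : P) :
    Continuous fun q : ℝ × B₁ => H q.1 (𝒯.i₁ q.2) (fun j => D j q.2) α :=
  hH.continuous.comp (by fun_prop :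
    Continuous fun q : ℝ × B₁ => (q.1, 𝒯.i₁ q.2, (fun j => D j q.2), α))

end Nonlinearity

section Solution

variable {n : ℕ} {H : ℝ → B → (Fin n → B) → P → B} {L L' Lpar : ℝ}
  {𝒯 : BanachTriple B₂ B₁ B} {D : Fin n → B₁ →L[ℝ] B} {S : ℝ → B →L[ℝ] B}
  {S₁ : ℝ → B₁ →L[ℝ] B₁} {M m M₁ m₁ κ ω β C γ θ a T : ℝ} {Y : B₁} {α : P} {b b' : ℝ → B₁}

lemma map_mildKernel [CompleteSpace B₁] [CompleteSpace B]
    (hS : SmoothingSemigroup 𝒯.i₁ S S₁ M m M₁ m₁ κ ω) (hβ : β ∈ Ioo (0 : ℝ) 1)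
    {t s : ℝ} (hst : s < t) :
    𝒯.i₁ (mildKernel 𝒯.i₁ S β (t - s) (H s (𝒯.i₁ (b s)) (fun j => D j (b s)) α)) =
      β • mildIntegrand 𝒯 S D H β α b t s := by
  rw [mildKernel, map_smul, hS.map_smoothDerivOp hβ (Real.rpow_pos_of_pos (by linarith) _),
    mul_smul, mildIntegrand]

lemma IsMildSolution.mono {I J : Set ℝ} (h : IsMildSolution 𝒯 S D H β a I Y α b) (hJ : J ⊆ I) :
    IsMildSolution 𝒯 S D H β a J Y α b :=
  ⟨h.continuousOn.mono hJ, fun t ht => h.integrable t (hJ ht), fun t ht => h.equation t (hJ ht)⟩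

lemma IsMildSolution.congr (h : IsMildSolution 𝒯 S D H β a (Icc a T) Y α b)
    (hb : EqOn b' b (Icc a T)) : IsMildSolution 𝒯 S D H β a (Icc a T) Y α b' := by
  have e : ∀ t ∈ Icc a T, EqOn (mildIntegrand 𝒯 S D H β α b t) (mildIntegrand 𝒯 S D H β α b' t)
      (uIcc a t) := by
    intro t ht s hs
    rw [uIcc_of_le ht.1] at hs
    simp only [mildIntegrand, hb ⟨hs.1, hs.2.trans ht.2⟩]
  refine ⟨h.continuousOn.congr hb, fun t ht => ?_, fun t ht => ?_⟩
  · exact (h.integrable t ht).congr ((e t ht).mono uIoc_subset_uIcc)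
  · rw [hb ht, h.equation t ht, intervalIntegral.integral_congr (e t ht)]

/-- Integrability and the equation at t involve only [a,t]. The strict inequality t < a + N is
needed for continuity, so that [a, a + N] is a neighbourhood of t in [a,∞). -/
lemma isMildSolution_Ici (h : ∀ N : ℕ, IsMildSolution 𝒯 S D H β a (Icc a (a + N)) Y α b) :
    IsMildSolution 𝒯 S D H β a (Ici a) Y α b := by
  have hN : ∀ t ∈ Ici a, ∃ N : ℕ, t < a + N := fun t _ => by
    obtain ⟨N, hN⟩ := exists_nat_gt (t - a)
    exact ⟨N, by linarith⟩
  refine ⟨fun t ht => ?_, fun t ht => ?_, fun t ht => ?_⟩ <;> obtain ⟨N, hN⟩ := hN t ht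
  · refine ((h N).continuousOn t ⟨ht, hN.le⟩).mono_of_mem_nhdsWithin ?_
    rw [← Ici_inter_Iic]
    exact inter_mem self_mem_nhdsWithin (mem_nhdsWithin_of_mem_nhds (Iic_mem_nhds hN))
  · exact (h N).integrable t ⟨ht, hN.le⟩
  · exact (h N).equation t ⟨ht, hN.le⟩

variable [NormedAddCommGroup P]

/-- The mild equation in `B` is a Volterra equation in `B₁`. -/
lemma isMildSolution_Icc_iff [CompleteSpace B₁] [CompleteSpace B]
    (hS : SmoothingSemigroup 𝒯.i₁ S S₁ M m M₁ m₁ κ ω) (hβ : β ∈ Ioo (0 : ℝ) 1)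
    (hH : HamiltonianBounds H L L' Lpar)
    (hk : WeaklySingular (mildKernel 𝒯.i₁ S β) C γ θ) (hθ : T - a ≤ θ) :
    IsMildSolution 𝒯 S D H β a (Icc a T) Y α b ↔
      ContinuousOn b (Icc a T) ∧ ∀ t ∈ Icc a T, b t = mittagLefflerOp S₁ β ((t - a) ^ β) Y +
        ∫ s in a..t, mildKernel 𝒯.i₁ S β (t - s) (H s (𝒯.i₁ (b s)) (fun j => D j (b s)) α) := by
  have hint : ContinuousOn b (Icc a T) → ∀ t ∈ Icc a T, IntervalIntegrable
      (fun s => mildKernel 𝒯.i₁ S β (t - s) (H s (𝒯.i₁ (b s)) (fun j => D j (b s)) α))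
      volume a t := fun hb t ht => by
    refine hk.intervalIntegrable ht.1 (by linarith [ht.2]) ?_
    exact (hH.continuous_comp 𝒯 D α).comp_continuousOn
      (continuousOn_id.prodMk (hb.mono (Icc_subset_Icc_right ht.2)))
  have hcongr : ∀ t ∈ Icc a T, ∀ᵐ s, s ∈ uIoc a t →
      𝒯.i₁ (mildKernel 𝒯.i₁ S β (t - s) (H s (𝒯.i₁ (b s)) (fun j => D j (b s)) α)) =
        β • mildIntegrand 𝒯 S D H β α b t s := fun t ht => by
    filter_upwards [Measure.ae_ne volume t] with s hs hsm
    rw [uIoc_of_le ht.1] at hsm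
    exact map_mildKernel hS hβ (lt_of_le_of_ne hsm.2 hs)
  have heq : ContinuousOn b (Icc a T) → ∀ t ∈ Icc a T,
      𝒯.i₁ (mittagLefflerOp S₁ β ((t - a) ^ β) Y +
        ∫ s in a..t, mildKernel 𝒯.i₁ S β (t - s) (H s (𝒯.i₁ (b s)) (fun j => D j (b s)) α)) =
      mittagLefflerOp S β ((t - a) ^ β) (𝒯.i₁ Y) +
        β • ∫ s in a..t, mildIntegrand 𝒯 S D H β α b t s := fun hb t ht => by
    rw [map_add, hS.map_mittagLefflerOp hβ (Real.rpow_nonneg (by linarith [ht.1]) _),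
      ← 𝒯.i₁.intervalIntegral_comp_comm (hint hb t ht), ← intervalIntegral.integral_smul]
    congr 1
    exact intervalIntegral.integral_congr_ae (hcongr t ht)
  constructor
  · intro h
    -- Both sides are elements of B₁ with equal images in B.
    refine ⟨h.continuousOn, fun t ht => hS.injective ?_⟩
    rw [heq h.continuousOn t ht, h.equation t ht]
  · rintro ⟨hb, h⟩
    refine ⟨hb, fun t ht => ?_, fun t ht => ?_⟩
    · have h1 : IntervalIntegrable (fun s => 𝒯.i₁ (mildKernel 𝒯.i₁ S β (t - s)
          (H s (𝒯.i₁ (b s)) (fun j => D j (b s)) α))) volume a t :=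
        ⟨𝒯.i₁.integrable_comp (hint hb t ht).1, 𝒯.i₁.integrable_comp (hint hb t ht).2⟩
      have h2 : IntervalIntegrable (fun s => β • mildIntegrand 𝒯 S D H β α b t s) volume a t :=
        h1.congr_ae ((ae_restrict_iff' measurableSet_uIoc).2 (hcongr t ht))
      have h3 := h2.smul β⁻¹
      refine h3.congr_ae (Eventually.of_forall fun s => ?_)
      simp [smul_smul, inv_mul_cancel₀ hβ.1.ne']
    · rw [h t ht, heq hb t ht]

lemma continuousOn_rpow_comp_mittagLefflerOp
    (hS : SmoothingSemigroup 𝒯.i₁ S S₁ M m M₁ m₁ κ ω) (hβ : β ∈ Ioo (0 : ℝ) 1) (Y : B₁) :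
    ContinuousOn (fun t => mittagLefflerOp S₁ β ((t - a) ^ β) Y) (Icc a T) := by
  refine (continuousOn_mittagLefflerOp hS.semigroup₁ hS.M₁_nonneg hS.m₁_nonneg hS.norm₁_le
    (Θ := (T - a) ^ β) hβ Y).comp ?_ fun t ht => ?_
  · exact (Real.continuous_rpow_const hβ.1.le).comp_continuousOn (by fun_prop)
  · exact ⟨Real.rpow_nonneg (by linarith [ht.1]) _,
      Real.rpow_le_rpow (by linarith [ht.1]) (by linarith [ht.2]) hβ.1.le⟩

lemma exists_isMildSolution_Icc [CompleteSpace B₁] [CompleteSpace B]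
    (hS : SmoothingSemigroup 𝒯.i₁ S S₁ M m M₁ m₁ κ ω) (hβ : β ∈ Ioo (0 : ℝ) 1)
    (hH : HamiltonianBounds H L L' Lpar) (hD : DerivationBounds 𝒯 D)
    (hL : 0 ≤ L) (hL' : 0 ≤ L') (haT : a ≤ T) (Y : B₁) (α : P) :
    ∃ b, IsMildSolution 𝒯 S D H β a (Icc a T) Y α b := by
  obtain ⟨C, hC0, hC⟩ := exists_abs_zolotarevWeight_le hβ ((m₁ + 1) * (T - a) ^ β + 1)
  have hk := hS.weaklySingular_mildKernel hβ hC0 hC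
  obtain ⟨b, hb, h⟩ := hk.exists_solution haT le_rfl
    (continuousOn_rpow_comp_mittagLefflerOp hS hβ Y) (hH.continuous_comp 𝒯 D α)
    (lam := L * n) (lam₁ := L * (1 + n)) (lam₂ := L' * n) (by positivity) (by positivity)
    (by positivity) (hH.norm_comp_le hD hL α) (hH.norm_comp_sub_le hD hL hL' α)
  exact ⟨b, (isMildSolution_Icc_iff hS hβ hH hk le_rfl).2 ⟨hb.continuousOn, h⟩⟩

lemma IsMildSolution.eqOn [CompleteSpace B₁] [CompleteSpace B]
    (hS : SmoothingSemigroup 𝒯.i₁ S S₁ M m M₁ m₁ κ ω) (hβ : β ∈ Ioo (0 : ℝ) 1)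
    (hH : HamiltonianBounds H L L' Lpar) (hD : DerivationBounds 𝒯 D)
    (hL : 0 ≤ L) (hL' : 0 ≤ L') (hb : IsMildSolution 𝒯 S D H β a (Icc a T) Y α b)
    (hb' : IsMildSolution 𝒯 S D H β a (Icc a T) Y α b') : EqOn b b' (Icc a T) := by
  intro t ht
  obtain ⟨C, hC0, hC⟩ := exists_abs_zolotarevWeight_le hβ ((m₁ + 1) * (T - a) ^ β + 1)
  have hk := hS.weaklySingular_mildKernel hβ hC0 hC
  obtain ⟨N, hN⟩ := isCompact_Icc.exists_bound_of_continuousOn hb.continuousOn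
  have hN0 : 0 ≤ N := (norm_nonneg _).trans (hN t ht)
  have hF := fun {b : ℝ → B₁} (hb : ContinuousOn b (Icc a T)) =>
    (hH.continuous_comp 𝒯 D α).comp_continuousOn (continuousOn_id.prodMk hb)
  -- The Lipschitz constant uses the bound N of b alone; the competitor b' is only assumed
  -- continuous.
  obtain ⟨μ, hμ, hq⟩ := exists_volterraNorm_le
    (C := C * (κ * (1 + M₁)) * Real.Gamma (2 - ω)) hk.γ_pos
    (ε := 1 / (2 * (L * (1 + n) * (1 + L' * n * N) + 1))) (by positivity)
  have h := hk.norm_sub_le le_rfl hb.continuousOn hb'.continuousOn (hF hb.continuousOn)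
    (hF hb'.continuousOn) ((isMildSolution_Icc_iff hS hβ hH hk le_rfl).1 hb).2
    ((isMildSolution_Icc_iff hS hβ hH hk le_rfl).1 hb').2 (G := 0) (P := 0) le_rfl
    (by positivity) hμ hq (fun t _ => by simp) (fun s hs => by
      rw [zero_add]
      refine (hH.norm_comp_sub_le hD hL hL' α s (b s) (b' s)).trans ?_
      gcongr
      exact hN s hs) ht
  simpa [sub_eq_zero] using h

lemma exists_isMildSolution_Ici [CompleteSpace B₁] [CompleteSpace B]
    (hS : SmoothingSemigroup 𝒯.i₁ S S₁ M m M₁ m₁ κ ω) (hβ : β ∈ Ioo (0 : ℝ) 1)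
    (hH : HamiltonianBounds H L L' Lpar) (hD : DerivationBounds 𝒯 D)
    (hL : 0 ≤ L) (hL' : 0 ≤ L') (a : ℝ) (Y : B₁) (α : P) :
    ∃ b, IsMildSolution 𝒯 S D H β a (Ici a) Y α b := by
  choose c hc using fun N : ℕ => exists_isMildSolution_Icc hS hβ hH hD hL hL'
    (show a ≤ a + N by simp) Y α
  -- At time t the solution on the shortest interval [a, a + N] containing t is taken; by uniqueness
  -- the longer ones agree with it.
  refine ⟨fun t => c ⌈t - a⌉₊ t, isMildSolution_Ici fun N => (hc N).congr fun t ht => ?_⟩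
  have h1 : ⌈t - a⌉₊ ≤ N := Nat.ceil_le.2 (by linarith [ht.2])
  have h2 : t ≤ a + ⌈t - a⌉₊ := by linarith [Nat.le_ceil (t - a)]
  have h3 : a + (⌈t - a⌉₊ : ℝ) ≤ a + N := by gcongr
  exact (hc _).eqOn hS hβ hH hD hL hL' ((hc N).mono (Icc_subset_Icc_right h3)) ⟨ht.1, h2⟩

end Solution

end Equation

/-! ### Lipschitz dependence on the data -/

/-- Lipschitz dependence of mild solutions on the initial value and on the parameter. -/
lemma exists_lipschitz_const (n : ℕ) {β M m M₁ m₁ κ ω L L' Lpar : ℝ}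
    (hβ : β ∈ Ioo (0 : ℝ) 1) (hω : ω ∈ Ioo (0 : ℝ) 1) (hM₁ : 0 ≤ M₁)
    (hL : 0 ≤ L) (hL' : 0 ≤ L') (hLpar : 0 ≤ Lpar) (θ r : ℝ) :
    ∃ K : ℝ, ∀ (B₂ : Type u₂) (B₁ : Type u₁) (B : Type u₀) (P : Type u₃)
      [NormedAddCommGroup B₂] [NormedSpace ℝ B₂]
      [NormedAddCommGroup B₁] [NormedSpace ℝ B₁] [CompleteSpace B₁]
      [NormedAddCommGroup B] [NormedSpace ℝ B] [CompleteSpace B]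
      [NormedAddCommGroup P]
      (𝒯 : BanachTriple B₂ B₁ B) (D : Fin n → B₁ →L[ℝ] B) (S : ℝ → B →L[ℝ] B)
      (S₁ : ℝ → B₁ →L[ℝ] B₁) (H : ℝ → B → (Fin n → B) → P → B),
      DerivationBounds 𝒯 D → SmoothingSemigroup 𝒯.i₁ S S₁ M m M₁ m₁ κ ω →
      HamiltonianBounds H L L' Lpar →
      ∀ (a T : ℝ) (Y Y' : B₁) (α α' : P) (b b' : ℝ → B₁), T - a = θ → L' * ‖Y‖ ≤ r →
        IsMildSolution 𝒯 S D H β a (Icc a T) Y α b →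
        IsMildSolution 𝒯 S D H β a (Icc a T) Y' α' b' →
        ∀ t ∈ Icc a T, ‖b t - b' t‖ ≤ K * (‖α - α'‖ * (1 + ‖Y‖) + ‖Y - Y'‖) := by
  have hβ0 := hβ.1
  have hγ : 0 < β * (1 - ω) := mul_pos hβ0 (by linarith [hω.2])
  -- C serves the smoothing kernel and C' the operator E_β on B₁. All constants are fixed before the
  -- spaces are introduced, which gives the uniformity.
  obtain ⟨C, hC0, hC⟩ := exists_abs_zolotarevWeight_le hβ ((m₁ + 1) * θ ^ β + 1)
  obtain ⟨C', hC'0, hC'⟩ := exists_abs_zolotarevWeight_le hβ (m₁ * θ ^ β + 1)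
  obtain ⟨μ, hμ, hq⟩ := exists_volterraNorm_le
    (C := C * (κ * (1 + M₁)) * Real.Gamma (2 - ω)) hγ
    (ε := 1 / (2 * (L * n + 1))) (by positivity)
  set C₀ := 1 / β * (C' * M₁) with hC₀
  have hC₀0 : 0 ≤ C₀ := by positivity
  -- Constant of the a priori bound ‖b‖ ≤ Q‖Y‖, obtained with the linear growth constant L n.
  set Q := 2 * C₀ * Real.exp (μ * θ) with hQ
  have hQ0 : 0 ≤ Q := by positivity
  -- Along b the Lipschitz constant of the nonlinearity is at most L(1 + n)(1 + nQr), since L'‖Y‖ ≤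
  -- r. The maximum with 0 keeps it nonnegative for arbitrary real r.
  obtain ⟨ν, hν, hq'⟩ := exists_volterraNorm_le
    (C := C * (κ * (1 + M₁)) * Real.Gamma (2 - ω)) hγ
    (ε := 1 / (2 * (L * (1 + n) * (1 + n * Q * max r 0) + 1))) (by positivity)
  refine ⟨2 * (C₀ + Lpar * (1 + n * Q)) * Real.exp (ν * θ), ?_⟩
  intro B₂ B₁ B P _ _ _ _ _ _ _ _ _ 𝒯 D S S₁ H hD hS hH a T Y Y' α α' b b' hθ hr hb hb' t ht
  subst hθ
  have hk := hS.weaklySingular_mildKernel hβ hC0 hC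
  have hF := fun (α : P) {b : ℝ → B₁} (hb : ContinuousOn b (Icc a T)) =>
    (hH.continuous_comp 𝒯 D α).comp_continuousOn (continuousOn_id.prodMk hb)
  have hv := ((isMildSolution_Icc_iff hS hβ hH hk le_rfl).1 hb).2
  have hv' := ((isMildSolution_Icc_iff hS hβ hH hk le_rfl).1 hb').2
  have hτ : ∀ t ∈ Icc a T, (t - a) ^ β ∈ Icc 0 ((T - a) ^ β) := fun t ht =>
    ⟨Real.rpow_nonneg (by linarith [ht.1]) _,
      Real.rpow_le_rpow (by linarith [ht.1]) (by linarith [ht.2]) hβ0.le⟩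
  have hop : ∀ t ∈ Icc a T, ∀ Y : B₁, ‖mittagLefflerOp S₁ β ((t - a) ^ β) Y‖ ≤ C₀ * ‖Y‖ :=
    fun t ht Y => norm_mittagLefflerOp_le hS.M₁_nonneg hS.m₁_nonneg hS.norm₁_le hβ0 hC'
      (hτ t ht) Y
  have hapriori : ∀ s ∈ Icc a T, ‖b s‖ ≤ Q * ‖Y‖ := by
    intro s hs
    -- The a priori bound is stability against the zero function, which solves the Volterra equation
    -- with zero data because the kernel is additive.
    have hzero : ∀ t ∈ Icc a T, (0 : B₁) = 0 + ∫ s in a..t, mildKernel 𝒯.i₁ S β (t - s) 0 := by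
      intro t ht
      have := hk.integral_sub ht.1 (by linarith [ht.2])
        (continuousOn_const (c := (0 : B))) (continuousOn_const (c := (0 : B)))
      rw [sub_self, sub_self] at this
      rw [zero_add, ← this]
    have h := hk.norm_sub_le (b' := fun _ => 0) (g' := fun _ => 0) (f' := fun _ => 0) le_rfl
      hb.continuousOn continuousOn_const (hF α hb.continuousOn) continuousOn_const hv hzero
      (G := C₀ * ‖Y‖) (P := 0) (lam := L * n) le_rfl (by positivity) hμ hq
      (fun t ht => by simpa using hop t ht Y)
      (fun s _ => by simpa using hH.norm_comp_le hD hL α s (b s)) hs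
    rw [sub_zero, add_zero] at h
    refine h.trans ?_
    rw [hQ]
    have : Real.exp (μ * (s - a)) ≤ Real.exp (μ * (T - a)) := by
      gcongr
      exact hs.2
    calc _ ≤ 2 * (C₀ * ‖Y‖) * Real.exp (μ * (T - a)) := by gcongr
      _ = _ := by ring
  have hmain := hk.norm_sub_le le_rfl hb.continuousOn hb'.continuousOn (hF α hb.continuousOn)
    (hF α' hb'.continuousOn) hv hv' (G := C₀ * ‖Y - Y'‖)
    (P := Lpar * ‖α - α'‖ * (1 + n * (Q * ‖Y‖)))
    (lam := L * (1 + n) * (1 + n * Q * max r 0)) (by positivity) (by positivity) hν hq'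
    (fun t ht => by
      rw [← mittagLefflerOp_sub hS.semigroup₁ hS.M₁_nonneg hS.m₁_nonneg hS.norm₁_le hβ
        (hτ t ht).1]
      exact hop t ht _)
    (fun s hs => by
      have h1 := hH.norm_comp_par_sub_le hD hLpar α α' s (b s)
      have h2 := hH.norm_comp_sub_le hD hL hL' α' s (b s) (b' s)
      have h3 : L' * n * ‖b s‖ ≤ n * Q * max r 0 := by
        calc L' * n * ‖b s‖ ≤ L' * n * (Q * ‖Y‖) := by gcongr; exact hapriori s hs
          _ = n * Q * (L' * ‖Y‖) := by ring
          _ ≤ _ := by gcongr; exact hr.trans (le_max_left _ _)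
      -- The parameter is changed first, at the solution b, whose size is controlled; the state is
      -- changed afterwards.
      refine (norm_sub_le_norm_sub_add_norm_sub _
        (H s (𝒯.i₁ (b s)) (fun j => D j (b s)) α') _).trans (add_le_add (h1.trans ?_)
          (h2.trans ?_))
      · gcongr
        exact hapriori s hs
      · gcongr) ht
  refine hmain.trans ?_
  have h1 : Real.exp (ν * (t - a)) ≤ Real.exp (ν * (T - a)) := by
    gcongr
    exact ht.2
  have h2 : Lpar * ‖α - α'‖ * (1 + n * (Q * ‖Y‖)) ≤
      Lpar * (1 + n * Q) * (‖α - α'‖ * (1 + ‖Y‖)) := by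
    have h3 : 1 + n * (Q * ‖Y‖) ≤ (1 + n * Q) * (1 + ‖Y‖) := by
      have : 0 ≤ n * Q := by positivity
      nlinarith [norm_nonneg Y]
    calc _ ≤ Lpar * ‖α - α'‖ * ((1 + n * Q) * (1 + ‖Y‖)) := by gcongr
      _ = _ := by ring
  have h4 : 0 ≤ C₀ * (‖α - α'‖ * (1 + ‖Y‖)) := by positivity
  have h5 : 0 ≤ Lpar * (1 + n * Q) * ‖Y - Y'‖ := by positivity
  calc _ ≤ 2 * (C₀ * ‖Y - Y'‖ + Lpar * (1 + n * Q) * (‖α - α'‖ * (1 + ‖Y‖))) *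
        Real.exp (ν * (T - a)) := by gcongr
    _ ≤ 2 * ((C₀ + Lpar * (1 + n * Q)) * (‖α - α'‖ * (1 + ‖Y‖) + ‖Y - Y'‖)) *
        Real.exp (ν * (T - a)) := by
        gcongr
        linarith
    _ = _ := by ring

end FracMild

end

/-- Well-posedness in `B₁` of the mild fractional equation. The function `K` is chosen after the
numerical constants only, before the spaces, the operators and `H`. Its arguments are the length
of the time interval and a bound `r` for `L' ‖Y‖`; for `L' = 0` one may take `r = 0`, and then the
constant does not depend on `Y`. -/
theorem mainTheorem1 (n : ℕ) (β M m M₁ m₁ κ ω L L' Lpar : ℝ)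
    (hβ : β ∈ Set.Ioo (0 : ℝ) 1) (hω : ω ∈ Set.Ioo (0 : ℝ) 1) (hκ : 0 < κ)
    (hM : 0 ≤ M) (hm : 0 ≤ m) (hM₁ : 0 ≤ M₁) (hm₁ : 0 ≤ m₁)
    (hL : 0 ≤ L) (hL' : 0 ≤ L') (hLpar : 0 ≤ Lpar) :
    ∃ K : ℝ → ℝ → ℝ,
      ∀ (B₂ : Type u₂) (B₁ : Type u₁) (B : Type u₀) (P : Type u₃)
        [NormedAddCommGroup B₂] [NormedSpace ℝ B₂] [CompleteSpace B₂]
        [NormedAddCommGroup B₁] [NormedSpace ℝ B₁] [CompleteSpace B₁]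
        [NormedAddCommGroup B] [NormedSpace ℝ B] [CompleteSpace B]
        [NormedAddCommGroup P] [NormedSpace ℝ P] [CompleteSpace P]
        (𝒯 : FracMild.BanachTriple B₂ B₁ B) (D : Fin n → B₁ →L[ℝ] B)
        (A : B₂ →L[ℝ] B) (S : ℝ → B →L[ℝ] B) (H : ℝ → B → (Fin n → B) → P → B),
        FracMild.DerivationBounds 𝒯 D →
        FracMild.GeneratesSemigroup 𝒯 A S M m M₁ m₁ →
        FracMild.HamiltonianBounds H L L' Lpar →
        FracMild.Smoothing 𝒯 S κ ω →
        -- the integrals that define `E_β(Aτ)` and `E_β'(Aτ)` converge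
        (∀ τ : ℝ, 0 ≤ τ → ∀ y : B,
          MeasureTheory.IntegrableOn (FracMild.mittagLefflerIntegrand S β τ y) (Set.Ioi 0) ∧
          MeasureTheory.IntegrableOn (FracMild.mittagLefflerDerivIntegrand S β τ y) (Set.Ioi 0)) ∧
        -- existence and uniqueness of a global solution
        (∀ (a : ℝ) (Y : B₁) (α : P), ∃ b : ℝ → B₁,
          FracMild.IsMildSolution 𝒯 S D H β a (Set.Ici a) Y α b ∧ b a = Y ∧
          ∀ T : ℝ, a ≤ T → ∀ b' : ℝ → B₁,
            FracMild.IsMildSolution 𝒯 S D H β a (Set.Icc a T) Y α b' →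
            Set.EqOn b' b (Set.Icc a T)) ∧
        -- Lipschitz dependence on the initial value and on the parameter
        (∀ (a T r : ℝ) (Y Y' : B₁) (α α' : P) (b b' : ℝ → B₁),
          L' * ‖Y‖ ≤ r →
          FracMild.IsMildSolution 𝒯 S D H β a (Set.Icc a T) Y α b →
          FracMild.IsMildSolution 𝒯 S D H β a (Set.Icc a T) Y' α' b' →
          ∀ t ∈ Set.Icc a T,
            ‖b t - b' t‖ ≤ K (T - a) r * (‖α - α'‖ * (1 + ‖Y‖) + ‖Y - Y'‖)) := by
  have hK := fun θ r => FracMild.exists_lipschitz_const.{u₀, u₁, u₂, u₃} n (m := m) (M := M)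
    (m₁ := m₁) (κ := κ) hβ hω hM₁ hL hL' hLpar θ r
  choose K hK using hK
  refine ⟨K, ?_⟩
  intro B₂ B₁ B P _ _ _ _ _ _ _ _ _ _ _ _ 𝒯 D A S H hD hA hH hs
  obtain ⟨S₁, hS⟩ := hA.exists_smoothingSemigroup hs hω hκ hM hm hM₁ hm₁
  refine ⟨fun τ hτ y => FracMild.integrableOn_mittagLefflerIntegrand hS.semigroup hM hm hS.norm_le
    hβ hτ y, fun a Y α => ?_, fun a T r Y Y' α α' b b' hr hb hb' =>
      hK (T - a) r B₂ B₁ B P 𝒯 D S S₁ H hD hS hH a T Y Y' α α' b b' rfl hr hb hb'⟩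
  obtain ⟨b, hb⟩ := FracMild.exists_isMildSolution_Ici hS hβ hH hD hL hL' a Y α
  refine ⟨b, hb, hS.injective ?_, fun T _ b' hb' =>
    hb'.eqOn hS hβ hH hD hL hL' (hb.mono Set.Icc_subset_Ici_self)⟩
  -- At t = a the integral is empty and E_β(0) = id by normalization of the weight.
  rw [hb.equation a Set.self_mem_Ici, sub_self, Real.zero_rpow hβ.1.ne',
    FracMild.mittagLefflerOp_zero hS.semigroup hβ, intervalIntegral.integral_same, smul_zero,
    add_zero]
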